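/- Let $\mathcal X$ be a finite alphabet, let $P_0,P_1$ be probability distributions on $\mathcal X$ that are strictly positive on $\mathcal X$, and let $\theta>0$. For $x=(x_1,\dots,x_n)\in\mathcal X^n$ write $P_i(x)=\prod_{k}P_i(x_k)$, and for $\Omega\subseteq\mathcal X^n$ write $P_i(\Omega)=\sum_{x\in\Omega}P_i(x)$. Logarithms are natural, $H$ is the entropy, $D(\cdot\|\cdot)$ is the Kullback–Leibler divergence, $Q$ always ranges over probability distributions on $\mathcal X$, and $E_Q f=\sum_x Q(x)f(x)$. For sequences that are positive for all large $n$, $a_n\doteq b_n$ means $\lim_n\frac1n\ln(a_n/b_n)=0$. A minimum over an empty set is $+\infty$. For real $\alpha,\beta$ and $n\ge0$ put $$\Omega_\star=\{x\in\mathcal X^n: P_1(x)^{1/(1+\theta)}+e^{n\alpha}P_0(x)\le e^{n\beta}P_1(x)\},\qquad \hat\Omega=\{x\in\mathcal X^n:\max\{P_1(x)^{1/(1+\theta)},e^{n\alpha}P_0(x)\}\le e^{n\beta}P_1(x)\}.$$ For $x\in\Omega$ let $L^*_\Omega(x)=-\ln\big[P_1(x)^{1/(1+\theta)}/\sum_{x'\in\Omega}P_1(x')^{1/(1+\theta)}\big]$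 and $C(\Omega)=\frac{1}{P_1(\Omega)}\sum_{x\in\Omega}P_1(x)e^{\theta L^*_\Omega(x)}$, which is $E_1[e^{\theta L^*_\Omega(X)}\mid X\in\Omega]$. Define $$e_1(\beta)=\min_Q\{D(Q\|P_1): E_Q\ln P_1\le-\beta(1+1/\theta)\},\qquad e_2(t)=\min_Q\{D(Q\|P_1):E_Q\ln(P_1/P_0)\le t\},$$ $$e_{MD}(\alpha,\beta)=\min_Q\{D(Q\|P_1):E_Q\ln P_1\le-\beta(1+1/\theta)\ \text{or}\ E_Q\ln(P_1/P_0)\le\alpha-\beta\},$$ $$e_{FA}(\alpha,\beta)=\min_Q\{D(Q\|P_0):-E_Q\ln P_1\le\beta(1+1/\theta),\ E_Q\ln(P_0/P_1)\le\beta-\alpha\},$$ $$e_c(\alpha,\beta)=\max_Q\{\theta H(Q)-D(Q\|P_1):E_Q\ln P_1\ge-\beta(1+1/\theta),\ E_Q\ln(P_1/P_0)\ge\alpha-\beta\}.$$ Call $(\alpha,\beta)$ strictly feasible if some $Q$ satisfies both constraints of $e_c$ (equivalently, of $e_{FA}$) with strict inequality. Then the following hold. 1. $\hat\Omega=\{x:-\ln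 P_1(x)\le n\beta(1+1/\theta),\ \ln[P_1(x)/P_0(x)]\ge n(\alpha-\beta)\}$, and $\Omega_\star$ and $\hat\Omega$ can only shrink when $\alpha$ increases with $\beta$ fixed. The minima $e_1,e_2,e_{MD},e_{FA}$ are attained whenever they are finite. 2. (Misdetection.) $e_{MD}(\alpha,\beta)=\min\{e_1(\beta),e_2(\alpha-\beta)\}$ for all $\alpha,\beta$. If $-\beta(1+1/\theta)\ne\min_x\ln P_1(x)$ and $\alpha-\beta\ne\min_x\ln[P_1(x)/P_0(x)]$, then: if $e_{MD}<\infty$, $P_1(\Omega_\star^c)\doteq P_1(\hat\Omega^c)\doteq e^{-ne_{MD}}$; if $e_{MD}=\infty$, then $\Omega_\star^c=\hat\Omega^c=\emptyset$ for all large $n$. 3. (Minimizers for misdetection.) If $-\beta(1+1/\theta)>\min_x\ln P_1(x)$, the unique minimizer for $e_1(\beta)$ is $Q_1\propto P_1^{\lambda}$ for some $\lambda\le1$. If $t>\min_x\ln[P_1(x)/P_0(x)]$, the unique minimizer for $e_2(t)$ is $Q_2\propto P_0^{\nu}P_1^{1-\nu}$ for some $\nu\ge0$. 4. (Shape of $e_1$,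 $e_2$.) $e_1$ is non-decreasing, and convex where finite; it is non-zero and finite exactly for $\theta H(P_1)/(1+\theta)<\beta\le-\theta\ln[\min_xP_1(x)]/(1+\theta)$, and is strictly increasing there. $e_2$ is non-increasing, and convex where finite; it is non-zero and finite exactly for $\min_x\ln[P_1(x)/P_0(x)]\le t<D(P_1\|P_0)$, and is strictly decreasing there. For each of $f=e_1,e_2$ and each real $E>0$ such that $E\le f(s)<\infty$ for some $s$, the equation $f(s)=E$ has exactly one solution. 5. (False alarm.) If $(\alpha,\beta)$ is strictly feasible, then $e_{FA}<\infty$, $P_0(\Omega_\star)\doteq P_0(\hat\Omega)\doteq e^{-ne_{FA}}$, and the unique minimizer for $e_{FA}$ is $Q^*\propto P_0^{1-\eta}P_1^{\eta+\xi}$ for some $\eta,\xi\ge0$. If $e_{FA}(\alpha,\beta)=\infty$, then $\Omega_\star=\hat\Omega=\emptyset$ for all $n\ge1$. For fixed $t$, put $\phi_t(\beta)=e_{FA}(\beta+t,\beta)$. Then $\phi_t$ is non-increasing, and strictly decreasing on the set where $\inf\phi_t<\phi_t(\beta)<\infty$; for each real $E>\inf\phi_t$ such that $E\le\phi_t(\beta)<\infty$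 for some $\beta$, the equation $\phi_t(\beta)=E$ has exactly one solution. 6. (Compression cost.) If $(\alpha,\beta)$ is strictly feasible, the maximum $e_c$ is attained and $\big(\sum_{x\in\hat\Omega}P_1(x)^{1/(1+\theta)}\big)^{1+\theta}\doteq e^{ne_c}$. If $e_{MD}(\alpha,\beta)>0$, then $(\alpha,\beta)$ is strictly feasible, $C(\Omega_\star)\doteq C(\hat\Omega)$ and $C(\Omega_\star)\doteq\big(\sum_{x\in\hat\Omega}P_1(x)^{1/(1+\theta)}\big)^{1+\theta}$ (so $C(\Omega_\star)\doteq e^{ne_c}$). 7. (Choice of $\alpha$ and $\beta$.) Let $E_{MD}>0$ and $E_{FA}$ be real, and let $b_1,t,b_F$ satisfy $e_1(b_1)=E_{MD}$, $e_2(t)=E_{MD}$ and $\phi_t(b_F)=E_{FA}$, that is, $b_1=e_1^{-1}(E_{MD})$, $t=e_2^{-1}(E_{MD})$, $b_F=e_{FA}^{-1}(E_{FA})$. Then for all $\alpha,\beta$: $e_{MD}(\alpha,\beta)\ge E_{MD}$ if and only if $\beta\ge b_1$ and $\alpha-\beta\le t$. If $E_{FA}>\inf\phi_t$, then $\phi_t(\beta)\ge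 E_{FA}$ if and only if $\beta\le b_F$. If $b_F\ge b_1$, then the choice $\alpha=b_F+t$, $\beta=b_F$ satisfies $e_{MD}(\alpha,\beta)\ge E_{MD}$ and $e_{FA}(\alpha,\beta)\ge E_{FA}$, and for every $\varepsilon>0$ and all large $n$, $P_1(\Omega_\star^c)\le e^{-n(E_{MD}-\varepsilon)}$ and $P_0(\Omega_\star)\le e^{-n(E_{FA}-\varepsilon)}$. -/

import Mathlib

open Filter Topology

namespace JointDetection

noncomputable section

variable {X : Type*} [Fintype X]

/-! ### Exponential equality, and single-letter information quantities -/

/-- Equality on the exponential scale of two (eventually positive) sequences: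
`lim (1/n) ln (a n / b n) = 0`. -/
def ExpEq (a b : ℕ → ℝ) : Prop :=
  (∀ᶠ n in atTop, 0 < a n ∧ 0 < b n) ∧
    Tendsto (fun n : ℕ => Real.log (a n / b n) / (n : ℝ)) atTop (𝓝 0)

/-- The expectation `E_Q f(X)`. -/
def mean (Q f : X → ℝ) : ℝ := ∑ x, Q x * f x

/-- The entropy `H(Q)`, in nats. -/
def entropy (Q : X → ℝ) : ℝ := ∑ x, Real.negMulLog (Q x)

/-- The Kullback-Leibler divergence `D(Q‖P)`, in nats, for `P` strictly positive
(a term with `Q x = 0` is zero). -/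
def kl (Q P : X → ℝ) : ℝ := ∑ x, Q x * Real.log (Q x / P x)

/-- The probability vector proportional to the weights `w`. -/
def normalize (w : X → ℝ) : X → ℝ := fun x => w x / ∑ y, w y

/-! ### Memoryless sources and decision rules -/

/-- `P(x) = ∏ i, P(x i)` for a vector `x` of length `n`. -/
def iid (P : X → ℝ) {n : ℕ} (x : Fin n → X) : ℝ := ∏ i, P (x i)

/-- The sum of `f` over the region `S`. -/
def sumOn {n : ℕ} (S : Set (Fin n → X)) (f : (Fin n → X) → ℝ) : ℝ :=
  ∑ x, S.indicator f x

/-- The probability of the region `S` under the memoryless source `P`. -/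
def prob (P : X → ℝ) {n : ℕ} (S : Set (Fin n → X)) : ℝ := sumOn S (iid P)

/-- The decision rule `Ω⋆`. -/
def omegaStar (P0 P1 : X → ℝ) (θ α β : ℝ) (n : ℕ) : Set (Fin n → X) :=
  {x | iid P1 x ^ (1 / (1 + θ)) + Real.exp (n * α) * iid P0 x ≤ Real.exp (n * β) * iid P1 x}

/-- The decision rule `Ω̂`. -/
def omegaHat (P0 P1 : X → ℝ) (θ α β : ℝ) (n : ℕ) : Set (Fin n → X) :=
  {x | max (iid P1 x ^ (1 / (1 + θ))) (Real.exp (n * α) * iid P0 x) ≤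
    Real.exp (n * β) * iid P1 x}

/-- `∑_{x ∈ Ω} P1(x)^{1/(1+θ)}`. -/
def powerSum (P1 : X → ℝ) (θ : ℝ) {n : ℕ} (Ω : Set (Fin n → X)) : ℝ :=
  sumOn Ω (fun x => iid P1 x ^ (1 / (1 + θ)))

/-- The ideal code length `L*` for the vectors of the region `Ω`. -/
def idealLength (P1 : X → ℝ) (θ : ℝ) {n : ℕ} (Ω : Set (Fin n → X)) (x : Fin n → X) : ℝ :=
  -Real.log (iid P1 x ^ (1 / (1 + θ)) / powerSum P1 θ Ω)

/-- The compression cost `E₁[exp{θ L*(X)} | X ∈ Ω]`. -/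
def cost (P1 : X → ℝ) (θ : ℝ) {n : ℕ} (Ω : Set (Fin n → X)) : ℝ :=
  sumOn Ω (fun x => iid P1 x * Real.exp (θ * idealLength P1 θ Ω x)) / prob P1 Ω

/-! ### The single-letter optimization problems -/

/-- Constraint set of `e₁(β)`. -/
def set1 (P1 : X → ℝ) (θ β : ℝ) : Set (X → ℝ) :=
  {Q | Q ∈ stdSimplex ℝ X ∧ mean Q (fun x => Real.log (P1 x)) ≤ -β * (1 + 1 / θ)}

/-- Constraint set of `e₂(t)`. -/
def set2 (P0 P1 : X → ℝ) (t : ℝ) : Set (X → ℝ) :=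
  {Q | Q ∈ stdSimplex ℝ X ∧ mean Q (fun x => Real.log (P1 x / P0 x)) ≤ t}

/-- Constraint set of the misdetection exponent. -/
def setMD (P0 P1 : X → ℝ) (θ α β : ℝ) : Set (X → ℝ) :=
  {Q | Q ∈ stdSimplex ℝ X ∧ (mean Q (fun x => Real.log (P1 x)) ≤ -β * (1 + 1 / θ) ∨
    mean Q (fun x => Real.log (P1 x / P0 x)) ≤ α - β)}

/-- Constraint set of the false-alarm exponent. -/
def setFA (P0 P1 : X → ℝ) (θ α β : ℝ) : Set (X → ℝ) :=
  {Q | Q ∈ stdSimplex ℝ X ∧ -mean Q (fun x => Real.log (P1 x)) ≤ β * (1 + 1 / θ) ∧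
    mean Q (fun x => Real.log (P0 x / P1 x)) ≤ β - α}

/-- Constraint set of the compression-cost exponent. -/
def setC (P0 P1 : X → ℝ) (θ α β : ℝ) : Set (X → ℝ) :=
  {Q | Q ∈ stdSimplex ℝ X ∧ -β * (1 + 1 / θ) ≤ mean Q (fun x => Real.log (P1 x)) ∧
    α - β ≤ mean Q (fun x => Real.log (P1 x / P0 x))}

/-- Some distribution satisfies both constraints of `setC` (equivalently of `setFA`) strictly. -/
def StrictlyFeasible (P0 P1 : X → ℝ) (θ α β : ℝ) : Prop :=
  ∃ Q ∈ stdSimplex ℝ X, -β * (1 + 1 / θ) < mean Q (fun x => Real.log (P1 x)) ∧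
    α - β < mean Q (fun x => Real.log (P1 x / P0 x))

/-- The minimal divergence from `P` over a set of distributions; `⊤` for the empty set. -/
def minKL (P : X → ℝ) (S : Set (X → ℝ)) : EReal := ⨅ Q ∈ S, ((kl Q P : ℝ) : EReal)

/-- `e₁(β)`. -/
def e1 (P1 : X → ℝ) (θ β : ℝ) : EReal := minKL P1 (set1 P1 θ β)

/-- `e₂(t)`. -/
def e2 (P0 P1 : X → ℝ) (t : ℝ) : EReal := minKL P1 (set2 P0 P1 t)

/-- The misdetection exponent. -/
def eMD (P0 P1 : X → ℝ) (θ α β : ℝ) : EReal := minKL P1 (setMD P0 P1 θ α β)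

/-- The false-alarm exponent. -/
def eFA (P0 P1 : X → ℝ) (θ α β : ℝ) : EReal := minKL P0 (setFA P0 P1 θ α β)

/-- `Q` is a minimizer of `D(·‖P)` over `S`. -/
def IsMinimizer (P : X → ℝ) (S : Set (X → ℝ)) (Q : X → ℝ) : Prop :=
  Q ∈ S ∧ IsMinOn (fun R => kl R P) S Q

end

end JointDetection

namespace JointDetection

variable {X : Type*} [Fintype X]

/-! ### Means, divergences, and their minima over sets of distributions -/

/-! After taking logarithms, membership in either region depends on `x` only through two empirical
means, of `ln P1` and of `ln (P1/P0)`. Up to a threshold shift bounded independently of `n`, both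
regions are a `slab`, cut out by linear constraints on the empirical distribution. Every exponent is
then Sanov's theorem for linear constraints: the `w`-mass of a slab decays at the rate of the
minimum of `D(Q‖w)` over the distributions satisfying them.

The upper bound is Chernoff's inequality with the Lagrange multipliers of that minimization as
exponents (`exists_multipliers`, `eventually_sumOn_slab_le_exp`). The lower bound changes measure to
a strictly feasible `Q` and applies the law of large numbers (`eventually_exp_le_sumOn_slab`).
Neither needs the method of types. The weights `w` need not sum to one, so one theorem,
`expEq_sumOn_of_slab`, serves false alarm (`w = P0`) and compression cost (`w = P1^{1/(1+θ)}`, since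
`θH(Q) - D(Q‖P1) = -(1+θ)D(Q‖w)`). Misdetection is a union of two single-constraint slabs.

The shape results follow from convexity: mixing a distribution with one of smaller divergence or
smaller mean shows that the minimum, as a function of one constraint level, is convex, strictly
monotone above its infimum, and invertible there. -/

lemma mean_mix (Q R f : X → ℝ) (a b : ℝ) :
    mean (a • Q + b • R) f = a * mean Q f + b * mean R f := by
  simp only [mean, Finset.mul_sum, ← Finset.sum_add_distrib, Pi.add_apply, Pi.smul_apply,
    smul_eq_mul]
  exact Finset.sum_congr rfl fun x _ => by ring

lemma mean_neg (Q f : X → ℝ) : mean Q (fun x => -f x) = -mean Q f := by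
  simp [mean]

@[fun_prop]
lemma continuous_mean (f : X → ℝ) : Continuous fun Q : X → ℝ => mean Q f := by
  unfold mean; fun_prop

/-- The perspective form `∑ P φ(Q/P)` with `φ(t) = t ln t` transfers the continuity of `φ` (also at
`0`) and its convexity to the divergence. -/
lemma kl_eq_sum {P : X → ℝ} (hP : ∀ x, 0 < P x) (Q : X → ℝ) :
    kl Q P = ∑ x, P x * (Q x / P x * Real.log (Q x / P x)) :=
  Finset.sum_congr rfl fun x _ => by have := (hP x).ne'; field_simp

lemma continuous_kl {P : X → ℝ} (hP : ∀ x, 0 < P x) : Continuous fun Q : X → ℝ => kl Q P := by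
  simp only [kl_eq_sum hP]
  refine continuous_finsetSum _ fun x _ => continuous_const.mul ?_
  exact Real.continuous_mul_log.comp ((continuous_apply x).div_const _)

lemma kl_mix_le {P Q R : X → ℝ} (hP : ∀ x, 0 < P x) (hQ : ∀ x, 0 ≤ Q x) (hR : ∀ x, 0 ≤ R x)
    {a b : ℝ} (ha : 0 ≤ a) (hb : 0 ≤ b) (hab : a + b = 1) :
    kl (a • Q + b • R) P ≤ a * kl Q P + b * kl R P := by
  simp only [kl_eq_sum hP, Finset.mul_sum, ← Finset.sum_add_distrib]
  refine Finset.sum_le_sum fun x _ => ?_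
  have h := Real.convexOn_mul_log.2 (x := Q x / P x) (y := R x / P x)
    (div_nonneg (hQ x) (hP x).le) (div_nonneg (hR x) (hP x).le) ha hb hab
  simp only [smul_eq_mul] at h
  have e : (a • Q + b • R) x / P x = a * (Q x / P x) + b * (R x / P x) := by
    simp only [Pi.add_apply, Pi.smul_apply, smul_eq_mul]; ring
  rw [e]
  nlinarith [mul_le_mul_of_nonneg_left h (hP x).le]

/-- The correction `P x - Q x` sums to zero for probability vectors. It makes every term
non-negative, and zero only where `Q x = P x`. -/
lemma kl_eq_sum_klFun {P Q : X → ℝ} (hP : ∀ x, 0 < P x) (hP1 : ∑ x, P x = 1)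
    (hQ1 : ∑ x, Q x = 1) :
    kl Q P = ∑ x, P x * InformationTheory.klFun (Q x / P x) := by
  have : ∑ x, P x * InformationTheory.klFun (Q x / P x) =
      ∑ x, (P x * (Q x / P x * Real.log (Q x / P x)) + (P x - Q x)) :=
    Finset.sum_congr rfl fun x _ => by
      have := (hP x).ne'
      rw [InformationTheory.klFun]; field_simp; ring
  rw [this, Finset.sum_add_distrib, ← kl_eq_sum hP, Finset.sum_sub_distrib, hP1, hQ1]
  ring

lemma kl_nonneg {P Q : X → ℝ} (hP : ∀ x, 0 < P x) (hPs : P ∈ stdSimplex ℝ X)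
    (hQ : Q ∈ stdSimplex ℝ X) : 0 ≤ kl Q P := by
  rw [kl_eq_sum_klFun hP hPs.2 hQ.2]
  exact Finset.sum_nonneg fun x _ => mul_nonneg (hP x).le
    (InformationTheory.klFun_nonneg (div_nonneg (hQ.1 x) (hP x).le))

lemma kl_self {P : X → ℝ} (hP : ∀ x, 0 < P x) : kl P P = 0 :=
  Finset.sum_eq_zero fun x _ => by rw [div_self (hP x).ne', Real.log_one, mul_zero]

lemma eq_of_kl_eq_zero {P Q : X → ℝ} (hP : ∀ x, 0 < P x) (hPs : P ∈ stdSimplex ℝ X)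
    (hQ : Q ∈ stdSimplex ℝ X) (h : kl Q P = 0) : Q = P := by
  rw [kl_eq_sum_klFun hP hPs.2 hQ.2, Finset.sum_eq_zero_iff_of_nonneg fun x _ =>
    mul_nonneg (hP x).le
      (InformationTheory.klFun_nonneg (div_nonneg (hQ.1 x) (hP x).le))] at h
  funext x
  have := (mul_eq_zero.1 (h x (Finset.mem_univ x))).resolve_left (hP x).ne'
  rw [InformationTheory.klFun_eq_zero_iff (div_nonneg (hQ.1 x) (hP x).le)] at this
  exact (div_eq_one_iff_eq (hP x).ne').1 this

lemma minKL_le {P Q : X → ℝ} {S : Set (X → ℝ)} (h : Q ∈ S) : minKL P S ≤ (kl Q P : ℝ) :=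
  iInf₂_le Q h

lemma minKL_anti (P : X → ℝ) {S T : Set (X → ℝ)} (h : S ⊆ T) : minKL P T ≤ minKL P S :=
  biInf_mono h

lemma le_minKL_iff {P : X → ℝ} {S : Set (X → ℝ)} {c : EReal} :
    c ≤ minKL P S ↔ ∀ Q ∈ S, c ≤ (kl Q P : ℝ) := le_iInf₂_iff

lemma minKL_ne_top_iff {P : X → ℝ} {S : Set (X → ℝ)} : minKL P S ≠ ⊤ ↔ S.Nonempty := by
  constructor
  · intro h
    by_contra hS
    rw [Set.not_nonempty_iff_eq_empty] at hS
    exact h (by simp [minKL, hS])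
  · rintro ⟨Q, hQ⟩ h
    have := minKL_le (P := P) hQ
    rw [h] at this
    exact EReal.coe_ne_top _ (top_le_iff.1 this)

lemma exists_minKL_eq {P : X → ℝ} (hP : ∀ x, 0 < P x) {S : Set (X → ℝ)} (hS : IsCompact S)
    (h : minKL P S ≠ ⊤) : ∃ Q ∈ S, minKL P S = (kl Q P : ℝ) := by
  obtain ⟨Q, hQ, hmin⟩ := hS.exists_isMinOn (minKL_ne_top_iff.1 h) (continuous_kl hP).continuousOn
  exact ⟨Q, hQ, le_antisymm (minKL_le hQ)
    (le_minKL_iff.2 fun R hR => EReal.coe_le_coe_iff.2 (hmin hR))⟩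

lemma minKL_union (P : X → ℝ) (S T : Set (X → ℝ)) :
    minKL P (S ∪ T) = min (minKL P S) (minKL P T) := iInf_union

lemma minKL_nonneg {P : X → ℝ} (hP : ∀ x, 0 < P x) (hPs : P ∈ stdSimplex ℝ X)
    {S : Set (X → ℝ)} (hS : S ⊆ stdSimplex ℝ X) : 0 ≤ minKL P S :=
  le_minKL_iff.2 fun _ hQ => EReal.coe_nonneg.2 (kl_nonneg hP hPs (hS hQ))

lemma minKL_eq_zero_iff {P : X → ℝ} (hP : ∀ x, 0 < P x) (hPs : P ∈ stdSimplex ℝ X)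
    {S : Set (X → ℝ)} (hS : S ⊆ stdSimplex ℝ X) (hc : IsCompact S) :
    minKL P S = 0 ↔ P ∈ S := by
  constructor
  · intro h
    obtain ⟨Q, hQ, e⟩ := exists_minKL_eq hP hc (by rw [h]; exact EReal.zero_ne_top)
    rw [h] at e
    rwa [← eq_of_kl_eq_zero hP hPs (hS hQ) (EReal.coe_eq_zero.1 e.symm)]
  · intro h
    refine le_antisymm ?_ (minKL_nonneg hP hPs hS)
    simpa [kl_self hP] using minKL_le (P := P) h

/-- The distributions whose means satisfy the linear constraints `E_Q (f j) ≤ a j`. -/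
def feasible {J : Type*} (f : J → X → ℝ) (a : J → ℝ) : Set (X → ℝ) :=
  {Q | Q ∈ stdSimplex ℝ X ∧ ∀ j, mean Q (f j) ≤ a j}

lemma isCompact_feasible {J : Type*} (f : J → X → ℝ) (a : J → ℝ) :
    IsCompact (feasible f a) := by
  refine (isCompact_stdSimplex ℝ X).inter_right (t := {Q | ∀ j, mean Q (f j) ≤ a j}) ?_
  rw [Set.ofPred_forall]
  exact isClosed_iInter fun j => isClosed_le (continuous_mean _) continuous_const

lemma convex_feasible {J : Type*} (f : J → X → ℝ) (a : J → ℝ) : Convex ℝ (feasible f a) := by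
  intro Q hQ R hR s t hs ht hst
  refine ⟨convex_stdSimplex ℝ X hQ.1 hR.1 hs ht hst, fun j => ?_⟩
  rw [mean_mix]
  have h1 := mul_le_mul_of_nonneg_left (hQ.2 j) hs
  have h2 := mul_le_mul_of_nonneg_left (hR.2 j) ht
  have h3 : s * a j + t * a j = a j := by rw [← add_mul, hst, one_mul]
  linarith

/-! ### Minimal divergence as a function of one constraint level -/

section Level

variable {P g : X → ℝ} {K : Set (X → ℝ)}

/-- The minimal divergence over `K` under the additional constraint `E_Q g ≤ u`. -/
noncomputable def levelKL (P g : X → ℝ) (K : Set (X → ℝ)) (u : ℝ) : EReal :=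
  minKL P {Q | Q ∈ K ∧ mean Q g ≤ u}

lemma levelKL_antitone : Antitone (levelKL P g K) := fun _ _ h =>
  minKL_anti P fun _ hQ => ⟨hQ.1, hQ.2.trans h⟩

lemma levelKL_le {Q : X → ℝ} {u : ℝ} (hQ : Q ∈ K) (h : mean Q g ≤ u) :
    levelKL P g K u ≤ (kl Q P : ℝ) :=
  minKL_le (S := {Q | Q ∈ K ∧ mean Q g ≤ u}) ⟨hQ, h⟩

lemma isCompact_level (hK : IsCompact K) (u : ℝ) : IsCompact {Q | Q ∈ K ∧ mean Q g ≤ u} :=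
  hK.inter_right (isClosed_le (continuous_mean _) continuous_const)

lemma iInf_levelKL_le {Q : X → ℝ} (hQ : Q ∈ K) :
    ⨅ u, levelKL P g K u ≤ (kl Q P : ℝ) :=
  (iInf_le _ (mean Q g)).trans (levelKL_le hQ le_rfl)

lemma exists_kl_lt_of_iInf_levelKL_lt {E : ℝ} (h : (⨅ u, levelKL P g K u) < (E : EReal)) :
    ∃ Q ∈ K, kl Q P < E := by
  obtain ⟨u, hu⟩ := iInf_lt_iff.1 h
  obtain ⟨Q, hQ⟩ := iInf_lt_iff.1 hu
  obtain ⟨hQ, hlt⟩ := iInf_lt_iff.1 hQ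
  exact ⟨Q, hQ.1, EReal.coe_lt_coe_iff.1 hlt⟩

/-- A mixture of the minimizers at two levels satisfies the mixed constraint, and the divergence is
convex in its first argument. -/
lemma convexOn_levelKL (hP : ∀ x, 0 < P x) (hKs : K ⊆ stdSimplex ℝ X) (hK : IsCompact K)
    (hKc : Convex ℝ K) :
    ConvexOn ℝ {u | levelKL P g K u ≠ ⊤} fun u => (levelKL P g K u).toReal := by
  have key : ∀ ⦃u⦄, levelKL P g K u ≠ ⊤ → ∀ ⦃v⦄, levelKL P g K v ≠ ⊤ → ∀ ⦃a b : ℝ⦄, 0 ≤ a →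
      0 ≤ b → a + b = 1 → levelKL P g K (a * u + b * v) ≤
        ((a * (levelKL P g K u).toReal + b * (levelKL P g K v).toReal : ℝ) : EReal) := by
    intro u hu v hv a b ha hb hab
    obtain ⟨Q, hQ, eQ⟩ := exists_minKL_eq hP (isCompact_level hK u) hu
    obtain ⟨R, hR, eR⟩ := exists_minKL_eq hP (isCompact_level hK v) hv
    rw [show levelKL P g K u = _ from eQ, show levelKL P g K v = _ from eR, EReal.toReal_coe,
      EReal.toReal_coe]
    refine (levelKL_le (hKc hQ.1 hR.1 ha hb hab) ?_).trans
      (EReal.coe_le_coe_iff.2 (kl_mix_le hP (hKs hQ.1).1 (hKs hR.1).1 ha hb hab))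
    rw [mean_mix]
    exact add_le_add (mul_le_mul_of_nonneg_left hQ.2 ha) (mul_le_mul_of_nonneg_left hR.2 hb)
  have ht : ∀ ⦃u⦄, levelKL P g K u ≠ ⊤ → ∀ ⦃v⦄, levelKL P g K v ≠ ⊤ → ∀ ⦃a b : ℝ⦄, 0 ≤ a →
      0 ≤ b → a + b = 1 → levelKL P g K (a * u + b * v) ≠ ⊤ :=
    fun u hu v hv a b ha hb hab h => by
      have := key hu hv ha hb hab
      rw [h] at this
      exact EReal.coe_ne_top _ (top_le_iff.1 this)
  refine ⟨fun u hu v hv a b ha hb hab => ht hu hv ha hb hab, fun u hu v hv a b ha hb hab => ?_⟩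
  have h1 := key hu hv ha hb hab
  obtain ⟨Q, -, eQ⟩ := exists_minKL_eq hP (isCompact_level hK _) (ht hu hv ha hb hab)
  simp only [smul_eq_mul]
  rw [levelKL, eQ, EReal.coe_le_coe_iff] at h1
  rwa [levelKL, eQ, EReal.toReal_coe]

/-- Mixing a distribution of small divergence with one of small mean. -/
lemma exists_mix {Q R : X → ℝ} {u E : ℝ} (hP : ∀ x, 0 < P x) (hKs : K ⊆ stdSimplex ℝ X)
    (hKc : Convex ℝ K) (hQ : Q ∈ K) (hR : R ∈ K) (hQE : kl Q P < E) (hQu : mean Q g ≤ u)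
    (hRu : mean R g < u) : ∃ S ∈ K, kl S P < E ∧ mean S g < u := by
  have hcont : Continuous fun s : ℝ => (1 - s) * kl Q P + s * kl R P := by fun_prop
  have h0 : ∀ᶠ s in 𝓝[>] (0 : ℝ), (1 - s) * kl Q P + s * kl R P < E :=
    nhdsWithin_le_nhds (hcont.continuousAt.eventually_lt continuousAt_const (by simpa using hQE))
  obtain ⟨s, hs, hs0, hs1⟩ := (h0.and (Ioo_mem_nhdsGT one_pos)).exists
  refine ⟨(1 - s) • Q + s • R, hKc hQ hR (by linarith) hs0.le (by ring),
    (kl_mix_le hP (hKs hQ).1 (hKs hR).1 (by linarith) hs0.le (by ring)).trans_lt hs, ?_⟩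
  rw [mean_mix]
  nlinarith

/-- If the values at `u < v` agreed, moving slightly from the minimizer at `u` towards any member of
`K` of smaller divergence would stay below level `v` and beat the common value. -/
lemma strictAntiOn_levelKL (hP : ∀ x, 0 < P x) (hKs : K ⊆ stdSimplex ℝ X) (hK : IsCompact K)
    (hKc : Convex ℝ K) :
    StrictAntiOn (levelKL P g K)
      {u | (⨅ v, levelKL P g K v) < levelKL P g K u ∧ levelKL P g K u ≠ ⊤} := by
  intro u hu v hv huv
  refine lt_of_le_of_ne (levelKL_antitone huv.le) fun he => ?_
  obtain ⟨Q, hQ, eQ⟩ := exists_minKL_eq hP (isCompact_level hK u) hu.2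
  have hu1 := hu.1
  rw [levelKL, eQ] at hu1
  obtain ⟨R, hR, hlt⟩ := exists_kl_lt_of_iInf_levelKL_lt hu1
  have hcont : Continuous fun s : ℝ => (1 - s) * mean Q g + s * mean R g := by fun_prop
  have h0 : ∀ᶠ s in 𝓝[>] (0 : ℝ), (1 - s) * mean Q g + s * mean R g < v :=
    nhdsWithin_le_nhds (hcont.continuousAt.eventually_lt continuousAt_const
      (by simpa using hQ.2.trans_lt huv))
  obtain ⟨s, hs, hs0, hs1⟩ := (h0.and (Ioo_mem_nhdsGT one_pos)).exists
  have h1 : levelKL P g K v ≤ (kl ((1 - s) • Q + s • R) P : ℝ) :=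
    levelKL_le (hKc hQ.1 hR (by linarith) hs0.le (by ring)) (by rw [mean_mix]; exact hs.le)
  have h2 := kl_mix_le hP (hKs hQ.1).1 (hKs hR).1 (a := 1 - s) (b := s) (by linarith) hs0.le
    (by ring)
  rw [he, levelKL, eQ, EReal.coe_le_coe_iff] at h1
  nlinarith

/-- The solution is exhibited directly, without a continuity argument, as the smallest mean of `g`
over the compact set of members of `K` with divergence at most `E`. -/
lemma existsUnique_levelKL_eq (hP : ∀ x, 0 < P x) (hKs : K ⊆ stdSimplex ℝ X) (hK : IsCompact K)
    (hKc : Convex ℝ K) {E : ℝ} (hE : (⨅ v, levelKL P g K v) < (E : EReal))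
    (hs : ∃ s, (E : EReal) ≤ levelKL P g K s ∧ levelKL P g K s ≠ ⊤) :
    ∃! u, levelKL P g K u = E := by
  obtain ⟨s, hEs, hst⟩ := hs
  obtain ⟨R, hR⟩ := minKL_ne_top_iff.1 hst
  obtain ⟨Q0, hQ0, hQ0E⟩ := exists_kl_lt_of_iInf_levelKL_lt hE
  obtain ⟨Q, hQ, hmin⟩ := (hK.inter_right (isClosed_le (continuous_kl hP)
    (continuous_const (y := E)))).exists_isMinOn ⟨Q0, hQ0, hQ0E.le⟩ (continuous_mean g).continuousOn
  have hle : levelKL P g K (mean Q g) ≤ E :=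
    (levelKL_le hQ.1 le_rfl).trans (EReal.coe_le_coe_iff.2 hQ.2)
  -- Were the value below `E`, mixing its witness with a distribution feasible at the lower level
  -- `s` would keep the divergence below `E` while reducing the mean, against the choice of `Q`.
  have heq : levelKL P g K (mean Q g) = E := by
    refine le_antisymm hle (le_of_not_gt fun hlt => ?_)
    have hsu : s < mean Q g := lt_of_not_ge fun h =>
      (hEs.trans (levelKL_antitone h)).not_gt hlt
    obtain ⟨T, hT⟩ := iInf_lt_iff.1 hlt
    obtain ⟨hT, hTE⟩ := iInf_lt_iff.1 hT
    obtain ⟨S, hS, hSE, hSu⟩ := exists_mix hP hKs hKc hT.1 hR.1 (EReal.coe_lt_coe_iff.1 hTE)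
      hT.2 (hR.2.trans_lt hsu)
    exact (hmin (show S ∈ _ from ⟨hS, hSE.le⟩)).not_gt hSu
  refine ⟨_, heq, fun v hv => ?_⟩
  have hmem : ∀ w, levelKL P g K w = E →
      w ∈ {u | (⨅ v, levelKL P g K v) < levelKL P g K u ∧ levelKL P g K u ≠ ⊤} := fun w hw =>
    ⟨by rw [hw]; exact hE, by rw [hw]; exact EReal.coe_ne_top _⟩
  exact (strictAntiOn_levelKL hP hKs hK hKc).injOn (hmem v hv) (hmem _ heq) (hv.trans heq.symm)

end Level

/-! ### Lagrange multipliers for the minimal divergence under linear constraints -/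

lemma normalize_mem_stdSimplex [Nonempty X] {w : X → ℝ} (hw : ∀ x, 0 < w x) :
    normalize w ∈ stdSimplex ℝ X := by
  have hZ : 0 < ∑ y, w y := Finset.sum_pos (fun y _ => hw y) Finset.univ_nonempty
  refine ⟨fun x => (div_pos (hw x) hZ).le, ?_⟩
  simp only [normalize, ← Finset.sum_div, div_self hZ.ne']

lemma normalize_pos [Nonempty X] {w : X → ℝ} (hw : ∀ x, 0 < w x) (x : X) : 0 < normalize w x :=
  div_pos (hw x) (Finset.sum_pos (fun y _ => hw y) Finset.univ_nonempty)

lemma normalize_const_mul {c : ℝ} (hc : c ≠ 0) (w : X → ℝ) :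
    normalize (fun x => c * w x) = normalize w := by
  funext x
  simp only [normalize, ← Finset.mul_sum, mul_div_mul_left _ _ hc]

lemma mean_normalize (w f : X → ℝ) : mean (normalize w) f = (∑ x, w x * f x) / ∑ x, w x := by
  simp only [mean, normalize, Finset.sum_div]
  exact Finset.sum_congr rfl fun x _ => by ring

lemma kl_eq_kl_add {Q R w : X → ℝ} (hR : ∀ x, 0 < R x) (hw : ∀ x, 0 < w x) :
    kl Q w = kl Q R + mean Q fun x => Real.log (R x / w x) := by
  simp only [kl, mean, ← Finset.sum_add_distrib]
  refine Finset.sum_congr rfl fun x _ => ?_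
  rcases eq_or_ne (Q x) 0 with h | h
  · simp [h]
  · rw [← mul_add, ← Real.log_mul (div_ne_zero h (hR x).ne') (div_ne_zero (hR x).ne' (hw x).ne'),
      div_mul_div_cancel₀ (hR x).ne']

lemma deriv_nonneg_of_le_right {ψ : ℝ → ℝ} {D : ℝ} (h : HasDerivAt ψ D 0)
    (hmin : ∀ t, 0 < t → t ≤ 1 → ψ 0 ≤ ψ t) : 0 ≤ D := by
  refine ge_of_tendsto h.tendsto_slope_zero_right ?_
  filter_upwards [Ioc_mem_nhdsGT (zero_lt_one' ℝ)] with t ht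
  rw [zero_add, smul_eq_mul]
  exact mul_nonneg (inv_nonneg.2 ht.1.le) (sub_nonneg.2 (hmin t ht.1 ht.2))

section Multipliers

variable {J : Type*} [Fintype J]

/-- The weights `w x * exp (-∑ j, l j * (f j x - a j))`. -/
noncomputable def tilt (w : X → ℝ) (f : J → X → ℝ) (a l : J → ℝ) (x : X) : ℝ :=
  w x * Real.exp (-∑ j, l j * (f j x - a j))

variable {w : X → ℝ} {f : J → X → ℝ} {a : J → ℝ}

omit [Fintype X] in
lemma tilt_pos (hw : ∀ x, 0 < w x) (l : J → ℝ) (x : X) : 0 < tilt w f a l x :=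
  mul_pos (hw x) (Real.exp_pos _)

lemma continuous_sum_tilt : Continuous fun l : J → ℝ => ∑ x, tilt w f a l x := by
  unfold tilt; fun_prop

lemma mean_sum_sub {Q : X → ℝ} (hQ : ∑ x, Q x = 1) (l : J → ℝ) :
    (mean Q fun x => ∑ j, l j * (f j x - a j)) = ∑ j, l j * (mean Q (f j) - a j) := by
  simp only [mean, Finset.mul_sum]
  rw [Finset.sum_comm]
  refine Finset.sum_congr rfl fun j _ => ?_
  have : l j * a j = ∑ x, Q x * (l j * a j) := by rw [← Finset.sum_mul, hQ, one_mul]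
  rw [mul_sub, this, Finset.mul_sum, ← Finset.sum_sub_distrib]
  exact Finset.sum_congr rfl fun x _ => by ring

/-- The dual function attains its minimum over the non-negative orthant. -/
lemma exists_min_sum_tilt (hw : ∀ x, 0 < w x) {R : X → ℝ} (hR : R ∈ stdSimplex ℝ X)
    (hs : ∀ j, mean R (f j) < a j) :
    ∃ l : J → ℝ, (∀ j, 0 ≤ l j) ∧
      ∀ m : J → ℝ, (∀ j, 0 ≤ m j) → ∑ x, tilt w f a l x ≤ ∑ x, tilt w f a m x := by
  have hX : Nonempty X := by
    by_contra h
    rw [not_nonempty_iff] at h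
    have := hR.2
    simp at this
  obtain ⟨x0, hx0⟩ := Finite.exists_min w
  -- Coercivity of the dual function: average `1 + y ≤ exp y` against the strictly feasible `R`,
  -- using `R x ≤ 1` and `w x0 ≤ w x`. The bound grows linearly in each multiplier.
  have hbound : ∀ m : J → ℝ, w x0 * (1 + ∑ j, m j * (a j - mean R (f j))) ≤
      ∑ x, tilt w f a m x := by
    intro m
    have h1 : 1 + ∑ j, m j * (a j - mean R (f j)) =
        ∑ x, R x * (1 + -∑ j, m j * (f j x - a j)) := by
      have := mean_sum_sub (f := f) (a := a) hR.2 m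
      simp only [mul_add, mul_neg, mul_one, Finset.sum_add_distrib, Finset.sum_neg_distrib, hR.2]
      rw [mean] at this
      rw [this, ← Finset.sum_neg_distrib]
      congr 1
      exact Finset.sum_congr rfl fun j _ => by ring
    rw [h1, Finset.mul_sum]
    refine Finset.sum_le_sum fun x _ => ?_
    have hR1 : R x ≤ 1 := hR.2 ▸ Finset.single_le_sum (fun y _ => hR.1 y) (Finset.mem_univ x)
    have he := Real.add_one_le_exp (-∑ j, m j * (f j x - a j))
    calc w x0 * (R x * (1 + -∑ j, m j * (f j x - a j)))
        ≤ w x0 * (R x * Real.exp (-∑ j, m j * (f j x - a j))) :=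
          mul_le_mul_of_nonneg_left (mul_le_mul_of_nonneg_left (by linarith) (hR.1 x)) (hw x0).le
      _ ≤ w x * (1 * Real.exp (-∑ j, m j * (f j x - a j))) :=
          mul_le_mul (hx0 x) (mul_le_mul_of_nonneg_right hR1 (Real.exp_pos _).le)
            (mul_nonneg (hR.1 x) (Real.exp_pos _).le) (hw x).le
      _ = tilt w f a m x := by rw [one_mul, tilt]
  set Z0 := ∑ x, tilt w f a 0 x
  have hZ0 : 0 < Z0 := Finset.sum_pos (fun x _ => tilt_pos hw _ x) Finset.univ_nonempty
  have hd : ∀ j, 0 < a j - mean R (f j) := fun j => sub_pos.2 (hs j)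
  -- Once `m j` exceeds `B j`, the bound exceeds `Z0`, the value at zero multipliers, so it suffices
  -- to minimize over the box.
  set B : J → ℝ := fun j => Z0 / (w x0 * (a j - mean R (f j)))
  have hB : ∀ j, 0 ≤ B j := fun j => div_nonneg hZ0.le (mul_pos (hw x0) (hd j)).le
  obtain ⟨l, hl, hmin⟩ := (isCompact_Icc (a := (0 : J → ℝ)) (b := B)).exists_isMinOn
    ⟨0, le_rfl, hB⟩ (continuous_sum_tilt (w := w) (f := f) (a := a)).continuousOn
  refine ⟨l, hl.1, fun m hm => ?_⟩
  by_cases hmB : m ≤ B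
  · exact hmin ⟨hm, hmB⟩
  · obtain ⟨j, hj⟩ : ∃ j, B j < m j := by simpa [Pi.le_def] using hmB
    have h1 : ∑ x, tilt w f a l x ≤ Z0 := hmin ⟨le_rfl, hB⟩
    have h2 : m j * (a j - mean R (f j)) ≤ ∑ j, m j * (a j - mean R (f j)) :=
      Finset.single_le_sum (fun j _ => mul_nonneg (hm j) (hd j).le) (Finset.mem_univ j)
    have h3 : Z0 < m j * (w x0 * (a j - mean R (f j))) :=
      (div_lt_iff₀ (mul_pos (hw x0) (hd j))).1 hj
    have h4 := hbound m
    nlinarith [mul_le_mul_of_nonneg_left h2 (hw x0).le, hw x0]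

/-- Under Slater's condition the minimal divergence is attained by an exponentially tilted
distribution, with non-negative multipliers. -/
theorem exists_multipliers (hw : ∀ x, 0 < w x) {R : X → ℝ} (hR : R ∈ stdSimplex ℝ X)
    (hs : ∀ j, mean R (f j) < a j) :
    ∃ l : J → ℝ, (∀ j, 0 ≤ l j) ∧ normalize (tilt w f a l) ∈ feasible f a ∧
      kl (normalize (tilt w f a l)) w = -Real.log (∑ x, tilt w f a l x) ∧
      ∀ Q ∈ feasible f a, kl Q (normalize (tilt w f a l)) + kl (normalize (tilt w f a l)) w ≤
        kl Q w := by
  have hX : Nonempty X := by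
    by_contra h
    rw [not_nonempty_iff] at h
    have := hR.2
    simp at this
  obtain ⟨l, hl, hmin⟩ := exists_min_sum_tilt hw hR hs
  have hu := tilt_pos (f := f) (a := a) hw l
  have hZ : 0 < ∑ x, tilt w f a l x := Finset.sum_pos (fun x _ => hu x) Finset.univ_nonempty
  have hN := normalize_mem_stdSimplex hu
  have hNpos := normalize_pos hu
  -- First-order condition: the one-sided derivative of the dual function at its minimizer `l`,
  -- along any direction staying in the orthant, is non-negative.
  have hdir : ∀ v : J → ℝ, (∀ t : ℝ, 0 < t → t ≤ 1 → ∀ j, 0 ≤ l j + t * v j) →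
      ∑ j, v j * (mean (normalize (tilt w f a l)) (f j) - a j) ≤ 0 := by
    intro v hv
    have hder : HasDerivAt (fun t : ℝ => ∑ x, tilt w f a (fun j => l j + t * v j) x)
        (∑ x, tilt w f a l x * -∑ j, v j * (f j x - a j)) 0 := by
      have : ∀ x ∈ Finset.univ, HasDerivAt (fun t : ℝ => tilt w f a (fun j => l j + t * v j) x)
          (tilt w f a l x * -∑ j, v j * (f j x - a j)) 0 := by
        intro x _
        have h1 : HasDerivAt (fun t : ℝ => -∑ j, (l j + t * v j) * (f j x - a j))
            (-∑ j, v j * (f j x - a j)) 0 := by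
          refine (HasDerivAt.fun_sum fun j _ => ?_).neg
          have := (((hasDerivAt_id (0 : ℝ)).mul_const (v j)).const_add (l j)).mul_const (f j x - a j)
          simpa using this
        have h2 := (h1.exp).const_mul (w x)
        simpa [tilt, mul_assoc] using h2
      exact HasDerivAt.fun_sum this
    have h0 := deriv_nonneg_of_le_right hder fun t ht ht1 => by
      simpa using hmin _ (hv t ht ht1)
    rw [← mean_sum_sub hN.2, mean_normalize]
    refine div_nonpos_of_nonpos_of_nonneg ?_ hZ.le
    simp only [mul_neg, Finset.sum_neg_distrib] at h0
    linarith
  -- The coordinate directions give primal feasibility; the directions `l` and `-l` below give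
  -- complementary slackness.
  have hfeas : normalize (tilt w f a l) ∈ feasible f a := by
    refine ⟨hN, fun j => ?_⟩
    classical
    have := hdir (Pi.single j 1) fun t ht _ i => by
      rcases eq_or_ne i j with rfl | h
      · simpa using add_nonneg (hl i) ht.le
      · simpa [Pi.single_eq_of_ne h] using hl i
    simpa [Pi.single_apply] using this
  have hslack : ∑ j, l j * (mean (normalize (tilt w f a l)) (f j) - a j) = 0 := by
    refine le_antisymm (hdir l fun t ht _ j => add_nonneg (hl j) (mul_nonneg ht.le (hl j))) ?_
    have := hdir (fun j => -l j) fun t ht ht1 j => by nlinarith [hl j]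
    simpa using this
  -- With complementary slackness, and with the last sum non-positive on the feasible set, this
  -- identity becomes the Pythagorean inequality.
  have hkl : ∀ Q ∈ stdSimplex ℝ X, kl Q w = kl Q (normalize (tilt w f a l)) -
      Real.log (∑ x, tilt w f a l x) - ∑ j, l j * (mean Q (f j) - a j) := by
    intro Q hQ
    rw [kl_eq_kl_add hNpos hw, ← mean_sum_sub hQ.2]
    have : ∀ x, Real.log (normalize (tilt w f a l) x / w x) =
        -Real.log (∑ x, tilt w f a l x) - ∑ j, l j * (f j x - a j) := by
      intro x
      have e : normalize (tilt w f a l) x / w x =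
          Real.exp (-∑ j, l j * (f j x - a j)) / ∑ x, tilt w f a l x := by
        have := (hw x).ne'
        simp only [normalize]
        rw [tilt]
        field_simp
      rw [e, Real.log_div (Real.exp_pos _).ne' hZ.ne', Real.log_exp]
      ring
    simp only [this, mean, mul_sub, Finset.sum_sub_distrib, ← Finset.sum_mul, hQ.2]
    ring
  have hself : kl (normalize (tilt w f a l)) w = -Real.log (∑ x, tilt w f a l x) := by
    rw [hkl _ hN, kl_self hNpos, hslack]; ring
  refine ⟨l, hl, hfeas, hself, fun Q hQ => ?_⟩
  have : ∑ j, l j * (mean Q (f j) - a j) ≤ 0 := Finset.sum_nonpos fun j _ =>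
    mul_nonpos_of_nonneg_of_nonpos (hl j) (sub_nonpos.2 (hQ.2 j))
  rw [hself, hkl Q hQ.1]
  linarith

omit [Fintype J] in
-- By the Pythagorean inequality, another minimizer would have zero divergence from `Q'`.
lemma isMinimizer_iff_of_multipliers {Q' : X → ℝ} (hpos : ∀ x, 0 < Q' x)
    (hmem : Q' ∈ feasible f a)
    (h : ∀ Q ∈ feasible f a, kl Q Q' + kl Q' w ≤ kl Q w) (Q : X → ℝ) :
    IsMinimizer w (feasible f a) Q ↔ Q = Q' := by
  constructor
  · rintro ⟨hQ, hmin⟩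
    have h1 : kl Q w ≤ kl Q' w := hmin hmem
    have h2 := h Q hQ
    exact eq_of_kl_eq_zero hpos hmem.1 hQ.1
      (le_antisymm (by linarith) (kl_nonneg hpos hmem.1 hQ.1))
  · rintro rfl
    refine ⟨hmem, fun R hR => ?_⟩
    have := kl_nonneg hpos hmem.1 hR.1
    have := h R hR
    simp only [Set.mem_ofPred_eq]
    linarith

end Multipliers

/-! ### Sums over regions of vectors -/

omit [Fintype X] in
lemma log_iid {w : X → ℝ} (hw : ∀ x, 0 < w x) {n : ℕ} (x : Fin n → X) :
    Real.log (iid w x) = ∑ i, Real.log (w (x i)) :=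
  Real.log_prod fun i _ => (hw (x i)).ne'

omit [Fintype X] in
lemma iid_pos {w : X → ℝ} (hw : ∀ x, 0 < w x) {n : ℕ} (x : Fin n → X) : 0 < iid w x :=
  Finset.prod_pos fun i _ => hw (x i)

omit [Fintype X] in
lemma iid_nonneg {w : X → ℝ} (hw : ∀ x, 0 ≤ w x) {n : ℕ} (x : Fin n → X) : 0 ≤ iid w x :=
  Finset.prod_nonneg fun i _ => hw (x i)

lemma sumOn_mono {n : ℕ} {S T : Set (Fin n → X)} {f g : (Fin n → X) → ℝ} (h : S ⊆ T)
    (hg : ∀ x, 0 ≤ g x) (hfg : ∀ x ∈ S, f x ≤ g x) : sumOn S f ≤ sumOn T g :=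
  Finset.sum_le_sum fun x _ => by
    by_cases hx : x ∈ S
    · rw [Set.indicator_of_mem hx, Set.indicator_of_mem (h hx)]
      exact hfg x hx
    · rw [Set.indicator_of_notMem hx]
      exact Set.indicator_nonneg (fun y _ => hg y) x

lemma sumOn_subset {n : ℕ} {S T : Set (Fin n → X)} {f : (Fin n → X) → ℝ} (h : S ⊆ T)
    (hf : ∀ x, 0 ≤ f x) : sumOn S f ≤ sumOn T f := sumOn_mono h hf fun _ _ => le_rfl

lemma sumOn_add_compl {n : ℕ} (S : Set (Fin n → X)) (f : (Fin n → X) → ℝ) :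
    sumOn S f + sumOn Sᶜ f = ∑ x, f x := by
  simp only [sumOn, ← Finset.sum_add_distrib]
  simp [Set.indicator_self_add_compl_apply]

lemma sumOn_iUnion_le {J : Type*} [Fintype J] {n : ℕ} (T : J → Set (Fin n → X))
    {f : (Fin n → X) → ℝ} (hf : ∀ x, 0 ≤ f x) : sumOn (⋃ j, T j) f ≤ ∑ j, sumOn (T j) f := by
  simp only [sumOn]
  rw [Finset.sum_comm]
  refine Finset.sum_le_sum fun x _ => ?_
  by_cases hx : x ∈ ⋃ j, T j
  · obtain ⟨j, hj⟩ := Set.mem_iUnion.1 hx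
    rw [Set.indicator_of_mem hx, ← Set.indicator_of_mem hj f]
    exact Finset.single_le_sum (f := fun j => (T j).indicator f x)
      (fun k _ => Set.indicator_nonneg (fun y _ => hf y) x) (Finset.mem_univ j)
  · rw [Set.indicator_of_notMem hx]
    exact Finset.sum_nonneg fun j _ => Set.indicator_nonneg (fun y _ => hf y) x

lemma sum_iid (w : X → ℝ) (n : ℕ) : ∑ x : Fin n → X, iid w x = (∑ x, w x) ^ n :=
  (Fintype.sum_pow w n).symm

/-- Chernoff's bound. -/
lemma sumOn_iid_le_pow {w : X → ℝ} (hw : ∀ x, 0 ≤ w x) (h : X → ℝ) {n : ℕ}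
    {S : Set (Fin n → X)} (hS : ∀ x ∈ S, ∑ i, h (x i) ≤ 0) :
    sumOn S (iid w) ≤ (∑ x, w x * Real.exp (-h x)) ^ n := by
  have e : ∀ x : Fin n → X, iid (fun y => w y * Real.exp (-h y)) x =
      iid w x * Real.exp (-∑ i, h (x i)) := fun x => by
    simp only [iid, Finset.prod_mul_distrib, ← Real.exp_sum, Finset.sum_neg_distrib]
  rw [← sum_iid]
  refine Finset.sum_le_sum fun x _ => ?_
  rw [e]
  by_cases hx : x ∈ S
  · rw [Set.indicator_of_mem hx]
    exact le_mul_of_one_le_right (iid_nonneg hw x) (Real.one_le_exp (neg_nonneg.2 (hS x hx)))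
  · rw [Set.indicator_of_notMem hx]
    exact mul_nonneg (iid_nonneg hw x) (Real.exp_pos _).le

/-- As a function of `t`, the exponential moment equals `1` at `t = 0` with slope `mean Q f - b <
0`, so it drops below `1` for some `t > 0`. -/
lemma exists_chernoff_rate {Q f : X → ℝ} (hQ : Q ∈ stdSimplex ℝ X) {b : ℝ} (h : mean Q f < b) :
    ∃ r : ℝ, 0 ≤ r ∧ r < 1 ∧ ∀ (n : ℕ) (S : Set (Fin n → X)),
      (∀ x ∈ S, n * b ≤ ∑ i, f (x i)) → sumOn S (iid Q) ≤ r ^ n := by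
  obtain ⟨t, ht, ht1⟩ : ∃ t : ℝ, 0 < t ∧ ∑ x, Q x * Real.exp (-(t * (b - f x))) < 1 := by
    by_contra! hcon
    have hder : HasDerivAt (fun t : ℝ => ∑ x, Q x * Real.exp (-(t * (b - f x))))
        (∑ x, Q x * -(b - f x)) 0 := by
      refine HasDerivAt.fun_sum fun x _ => ?_
      simpa using ((((hasDerivAt_id (0 : ℝ)).mul_const (b - f x)).neg).exp).const_mul (Q x)
    have h0 := deriv_nonneg_of_le_right hder fun t ht _ => by simpa [hQ.2] using hcon t ht
    simp only [neg_sub, mul_sub, Finset.sum_sub_distrib, ← Finset.sum_mul, hQ.2] at h0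
    simp only [mean] at h
    linarith
  refine ⟨_, Finset.sum_nonneg fun x _ => mul_nonneg (hQ.1 x) (Real.exp_pos _).le, ht1,
    fun n S hS => sumOn_iid_le_pow hQ.1 _ fun x hx => ?_⟩
  rw [← Finset.mul_sum, Finset.sum_sub_distrib]
  have := hS x hx
  simp only [Finset.sum_const, Finset.card_univ, Fintype.card_fin, nsmul_eq_mul]
  exact mul_nonpos_of_nonneg_of_nonpos ht.le (by linarith)

/-- The vectors `x` with `∑ i, f j (x i) ≤ n * a j + s` for all `j`. -/
def slab {J : Type*} (f : J → X → ℝ) (a : J → ℝ) (n : ℕ) (s : ℝ) : Set (Fin n → X) :=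
  {x | ∀ j, ∑ i, f j (x i) ≤ n * a j + s}

/-! ### Large-deviation bounds for slabs -/

section

variable {J : Type*} [Fintype J] {w : X → ℝ} {f : J → X → ℝ} {a : J → ℝ}

/-- The weak law of large numbers for finitely many functions. -/
lemma tendsto_prob_slab {Q : X → ℝ} (hQ : Q ∈ stdSimplex ℝ X) (h : ∀ j, mean Q (f j) < a j) :
    Tendsto (fun n : ℕ => prob Q (slab f a n 0)) atTop (𝓝 1) := by
  choose r hr0 hr1 hr using fun j => exists_chernoff_rate hQ (h j)
  have hlow : ∀ n : ℕ, 1 - ∑ j, r j ^ n ≤ prob Q (slab f a n 0) := by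
    intro n
    have h1 := sumOn_add_compl (slab f a n 0) (iid Q)
    rw [sum_iid, hQ.2, one_pow] at h1
    have h2 : (slab f a n 0)ᶜ ⊆ ⋃ j, {x : Fin n → X | n * a j ≤ ∑ i, f j (x i)} := by
      intro x hx
      simp only [slab, Set.mem_compl_iff, Set.mem_ofPred_eq, not_forall, not_le, add_zero] at hx
      obtain ⟨j, hj⟩ := hx
      exact Set.mem_iUnion.2 ⟨j, hj.le⟩
    have h3 := (sumOn_subset h2 (iid_nonneg hQ.1)).trans (sumOn_iUnion_le _ (iid_nonneg hQ.1))
    have h4 : ∑ j, sumOn {x : Fin n → X | n * a j ≤ ∑ i, f j (x i)} (iid Q) ≤ ∑ j, r j ^ n :=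
      Finset.sum_le_sum fun j _ => hr j n _ fun x hx => hx
    rw [prob]
    linarith
  have hup : ∀ n : ℕ, prob Q (slab f a n 0) ≤ 1 := by
    intro n
    have h1 := sumOn_add_compl (slab f a n 0) (iid Q)
    rw [sum_iid, hQ.2, one_pow] at h1
    have h2 : 0 ≤ sumOn (slab f a n 0)ᶜ (iid Q) := Finset.sum_nonneg fun x _ =>
      Set.indicator_nonneg (fun y _ => iid_nonneg hQ.1 y) x
    rw [prob]
    linarith
  refine tendsto_of_tendsto_of_tendsto_of_le_of_le ?_ tendsto_const_nhds hlow hup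
  have : Tendsto (fun n : ℕ => ∑ j, r j ^ n) atTop (𝓝 (∑ _j : J, 0)) :=
    tendsto_finsetSum _ fun j _ => tendsto_pow_atTop_nhds_zero_of_lt_one (hr0 j) (hr1 j)
  simpa using this.const_sub 1

lemma eventually_exp_neg_mul_le {c : ℝ} (hc : 0 < c) {b : ℝ} (hb : 0 < b) :
    ∀ᶠ n : ℕ in atTop, Real.exp (-(n * c)) ≤ b := by
  have : Tendsto (fun n : ℕ => Real.exp (-(n * c))) atTop (𝓝 0) :=
    Real.tendsto_exp_neg_atTop_nhds_zero.comp (tendsto_natCast_atTop_atTop.atTop_mul_const hc)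
  exact (this.eventually_lt_const hb).mono fun n hn => hn.le

/-- Lower bound on the exponential scale, by a change of measure. -/
theorem eventually_exp_le_sumOn_slab (hw : ∀ x, 0 < w x) {Q : X → ℝ} (hQ : Q ∈ stdSimplex ℝ X)
    (hs : ∀ j, mean Q (f j) < a j) {m : ℝ} (hm : kl Q w < m) :
    ∃ δ : ℝ, 0 < δ ∧
      ∀ᶠ n : ℕ in atTop, Real.exp (-(n * m)) ≤ sumOn (slab f a n (-(n * δ))) (iid w) := by
  obtain ⟨δ, hδ, hδ0⟩ : ∃ δ : ℝ, (∀ j, mean Q (f j) < a j - δ) ∧ 0 < δ := by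
    have h1 : ∀ᶠ δ in 𝓝[>] (0 : ℝ), ∀ j, mean Q (f j) < a j - δ :=
      eventually_all.2 fun j => nhdsWithin_le_nhds (continuousAt_const.eventually_lt
        (continuousAt_const.sub continuousAt_id) (by simpa using hs j))
    exact (h1.and self_mem_nhdsWithin).exists
  obtain ⟨m1, hm1, hm1m⟩ := exists_between hm
  refine ⟨δ, hδ0, ?_⟩
  -- The extra index `none` constrains the log-likelihood ratio `ln (Q/w)`, whose mean `kl Q w` lies
  -- below `m1`. The law of large numbers thus also controls the change of measure.
  have hlln := tendsto_prob_slab hQ (J := Option J)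
    (f := fun o => o.elim (fun x => Real.log (Q x / w x)) f)
    (a := fun o => o.elim m1 fun j => a j - δ) (by rintro (_ | j); exacts [hm1, hδ j])
  filter_upwards [hlln.eventually_const_le (show (1 / 2 : ℝ) < 1 by norm_num),
    eventually_exp_neg_mul_le (sub_pos.2 hm1m) (show (0 : ℝ) < 1 / 2 by norm_num)] with n h1 h2
  have h3 : Real.exp (-(n * m1)) * prob Q (slab (fun o : Option J =>
      o.elim (fun x => Real.log (Q x / w x)) f) (fun o => o.elim m1 fun j => a j - δ) n 0) ≤
      sumOn (slab f a n (-(n * δ))) (iid w) := by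
    rw [prob, sumOn, Finset.mul_sum]
    have e : ∀ (S : Set (Fin n → X)) (x : Fin n → X), Real.exp (-(n * m1)) * S.indicator (iid Q) x
        = S.indicator (fun x => Real.exp (-(n * m1)) * iid Q x) x := fun S x => by
      by_cases hx : x ∈ S <;> simp [hx]
    simp only [e]
    refine sumOn_mono ?_ (fun x => (iid_pos hw x).le) ?_
    · intro x hx j
      have := hx (some j)
      simp only [Option.elim] at this
      linarith
    · intro x hx
      have hx0 := hx none
      simp only [Option.elim, add_zero] at hx0
      -- When `Q` vanishes at some letter, the default `Real.log 0 = 0` makes the ratio constraint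
      -- meaningless, but then `iid Q x = 0` and nothing is left to bound.
      by_cases hz : ∃ i, Q (x i) = 0
      · obtain ⟨i, hi⟩ := hz
        rw [iid, Finset.prod_eq_zero (Finset.mem_univ i) hi, mul_zero]
        exact (iid_pos hw x).le
      · push Not at hz
        have hQx : 0 < iid Q x := Finset.prod_pos fun i _ => (hQ.1 _).lt_of_ne' (hz i)
        have hsum : ∑ i, Real.log (Q (x i) / w (x i)) = Real.log (iid Q x) - Real.log (iid w x) := by
          rw [log_iid hw, iid, Real.log_prod fun i _ => hz i, ← Finset.sum_sub_distrib]
          exact Finset.sum_congr rfl fun i _ => Real.log_div (hz i) (hw _).ne'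
        rw [← Real.log_le_log_iff (mul_pos (Real.exp_pos _) hQx) (iid_pos hw x),
          Real.log_mul (Real.exp_pos _).ne' hQx.ne', Real.log_exp]
        linarith
  calc Real.exp (-(n * m)) = Real.exp (-(n * m1)) * Real.exp (-(n * (m - m1))) := by
        rw [← Real.exp_add]; ring_nf
    _ ≤ _ := mul_le_mul_of_nonneg_left (h2.trans h1) (Real.exp_pos _).le
    _ ≤ _ := h3

/-- The empirical distribution of a vector. -/
lemma exists_empirical {n : ℕ} (hn : 0 < n) (x : Fin n → X) :
    ∃ Q ∈ stdSimplex ℝ X, ∀ g : X → ℝ, mean Q g = (∑ i, g (x i)) / n := by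
  classical
  have hn' : (n : ℝ) ≠ 0 := by positivity
  have hm : ∀ g : X → ℝ, mean (fun y => (∑ i, if x i = y then (1 : ℝ) else 0) / n) g =
      (∑ i, g (x i)) / n := by
    intro g
    simp only [mean, div_mul_eq_mul_div, ← Finset.sum_div, Finset.sum_mul]
    rw [Finset.sum_comm]
    simp
  refine ⟨_, ⟨fun y => ?_, ?_⟩, hm⟩
  · exact div_nonneg (Finset.sum_nonneg fun i _ => by split_ifs <;> norm_num) n.cast_nonneg
  · simpa [mean, hn'] using hm fun _ => 1

omit [Fintype J] in
-- Otherwise the compact sets of relaxed feasible points with divergence at most `M`, for slacks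
-- `1/(k+1)`, are nested and non-empty. A common point would be feasible with divergence at most
-- `M`.
lemma exists_relaxed_le (hw : ∀ x, 0 < w x) {M : ℝ} (hM : (M : EReal) < minKL w (feasible f a)) :
    ∃ δ : ℝ, 0 < δ ∧ ∀ Q ∈ feasible f fun j => a j + δ, M ≤ kl Q w := by
  by_contra! hcon
  have hcl : IsClosed {Q : X → ℝ | kl Q w ≤ M} := isClosed_le (continuous_kl hw) continuous_const
  have hne := IsCompact.nonempty_iInter_of_sequence_nonempty_isCompact_isClosed
    (fun k : ℕ => feasible f (fun j => a j + 1 / ((k : ℝ) + 1)) ∩ {Q : X → ℝ | kl Q w ≤ M})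
    (fun k Q hQ => ⟨⟨hQ.1.1, fun j => (hQ.1.2 j).trans (add_le_add le_rfl
      (one_div_le_one_div_of_le (by positivity) (by push_cast; linarith)))⟩, hQ.2⟩)
    (fun k => by
      obtain ⟨Q, hQ, hlt⟩ := hcon _ (show (0 : ℝ) < 1 / ((k : ℝ) + 1) by positivity)
      exact ⟨Q, hQ, hlt.le⟩)
    ((isCompact_feasible _ _).inter_right hcl)
    (fun k => (isCompact_feasible _ _).isClosed.inter hcl)
  obtain ⟨Q, hQ⟩ := hne
  rw [Set.mem_iInter] at hQ
  have hQf : Q ∈ feasible f a := by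
    refine ⟨(hQ 0).1.1, fun j => ?_⟩
    have hlim : Tendsto (fun k : ℕ => a j + 1 / ((k : ℝ) + 1)) atTop (𝓝 (a j + 0)) :=
      tendsto_one_div_add_atTop_nhds_zero_nat.const_add _
    rw [add_zero] at hlim
    exact ge_of_tendsto' hlim fun k => (hQ k).1.2 j
  exact ((minKL_le hQf).trans (EReal.coe_le_coe_iff.2 (hQ 0).2)).not_gt hM

lemma eventually_le_natCast_mul (K : ℝ) {δ : ℝ} (hδ : 0 < δ) : ∀ᶠ n : ℕ in atTop, K ≤ n * δ :=
  (tendsto_natCast_atTop_atTop.atTop_mul_const hδ).eventually_ge_atTop K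

/-- Upper bound on the exponential scale. -/
theorem eventually_sumOn_slab_le_exp (hw : ∀ x, 0 < w x) {M : ℝ}
    (hM : (M : EReal) < minKL w (feasible f a)) (K : ℝ) :
    ∀ᶠ n : ℕ in atTop, sumOn (slab f a n K) (iid w) ≤ Real.exp (-(n * M)) := by
  obtain ⟨δ, hδ, hle⟩ := exists_relaxed_le hw hM
  -- Slater's condition is not assumed for `a`. If it holds at level `a + δ`, the multipliers there
  -- give Chernoff's bound, with `n * δ` absorbing `K`. If not, no empirical distribution can lie in
  -- the slab once `n * δ > K`.
  by_cases hs : ∃ R ∈ stdSimplex ℝ X, ∀ j, mean R (f j) < a j + δ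
  · obtain ⟨R, hR, hs⟩ := hs
    obtain ⟨l, hl, hmem, hkl, -⟩ := exists_multipliers hw hR hs
    have hne : (Finset.univ : Finset X).Nonempty := by
      rw [Finset.univ_nonempty_iff]
      by_contra h
      rw [not_nonempty_iff] at h
      have := hR.2
      simp at this
    have hZ : 0 < ∑ x, tilt w f (fun j => a j + δ) l x :=
      Finset.sum_pos (fun x _ => tilt_pos hw l x) hne
    have hMZ : Real.log (∑ x, tilt w f (fun j => a j + δ) l x) ≤ -M := by
      have := hle _ hmem
      linarith
    filter_upwards [eventually_le_natCast_mul K hδ] with n hn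
    have h1 := sumOn_iid_le_pow (fun x => (hw x).le)
      (fun x => ∑ j, l j * (f j x - (a j + δ))) (n := n) (S := slab f a n K) fun x hx => by
        rw [Finset.sum_comm]
        refine Finset.sum_nonpos fun j _ => ?_
        rw [← Finset.mul_sum, Finset.sum_sub_distrib]
        have := hx j
        simp only [Finset.sum_const, Finset.card_univ, Fintype.card_fin, nsmul_eq_mul]
        exact mul_nonpos_of_nonneg_of_nonpos (hl j) (by linarith)
    refine h1.trans ?_
    change (∑ x, tilt w f (fun j => a j + δ) l x) ^ n ≤ _
    rw [← Real.exp_log hZ, ← Real.exp_nat_mul]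
    exact Real.exp_le_exp.2 (by
      have := mul_le_mul_of_nonneg_left hMZ (Nat.cast_nonneg (α := ℝ) n)
      linarith)
  · push Not at hs
    filter_upwards [eventually_le_natCast_mul (K + 1) hδ, eventually_gt_atTop 0] with n hn hn0
    have : slab f a n K = ∅ := by
      rw [Set.eq_empty_iff_forall_notMem]
      intro x hx
      obtain ⟨Q, hQ, hm⟩ := exists_empirical hn0 x
      obtain ⟨j, hj⟩ := hs Q hQ
      have hn0' : (0 : ℝ) < n := Nat.cast_pos.2 hn0
      rw [hm, le_div_iff₀ hn0'] at hj
      have := hx j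
      linarith
    rw [this, sumOn]
    simp [(Real.exp_pos _).le]

omit [Fintype J] in
/-- Under Slater's condition, strictly feasible distributions come close to the minimum. -/
lemma exists_strict_kl_lt (hw : ∀ x, 0 < w x) {R : X → ℝ} (hR : R ∈ stdSimplex ℝ X)
    (hs : ∀ j, mean R (f j) < a j) {m : ℝ} (hm : minKL w (feasible f a) < m) :
    ∃ Q ∈ stdSimplex ℝ X, (∀ j, mean Q (f j) < a j) ∧ kl Q w < m := by
  obtain ⟨Q, hQ⟩ := iInf_lt_iff.1 hm
  obtain ⟨hQ, hlt⟩ := iInf_lt_iff.1 hQ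
  have hcont : Continuous fun s : ℝ => (1 - s) * kl Q w + s * kl R w := by fun_prop
  have h0 : ∀ᶠ s in 𝓝[>] (0 : ℝ), (1 - s) * kl Q w + s * kl R w < m :=
    nhdsWithin_le_nhds (hcont.continuousAt.eventually_lt continuousAt_const
      (by simpa using EReal.coe_lt_coe_iff.1 hlt))
  obtain ⟨s, hs', hs0, hs1⟩ := (h0.and (Ioo_mem_nhdsGT one_pos)).exists
  refine ⟨(1 - s) • Q + s • R, convex_stdSimplex ℝ X hQ.1 hR (by linarith) hs0.le (by ring),
    fun j => ?_, (kl_mix_le hw hQ.1.1 hR.1 (by linarith) hs0.le (by ring)).trans_lt hs'⟩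
  rw [mean_mix]
  have h1 := mul_le_mul_of_nonneg_left (hQ.2 j) (sub_nonneg.2 hs1.le)
  have h2 := mul_lt_mul_of_pos_left (hs j) hs0
  linarith

end

/-! ### Equality on the exponential scale -/

lemma expEq_of_bounds {A : ℕ → ℝ} {m : ℝ}
    (hlow : ∀ ε > 0, ∀ᶠ n : ℕ in atTop, Real.exp (-(n * (m + ε))) ≤ A n)
    (hup : ∀ ε > 0, ∀ᶠ n : ℕ in atTop, A n ≤ Real.exp (-(n * (m - ε)))) :
    ExpEq A fun n => Real.exp (-(n * m)) := by
  refine ⟨(hlow 1 one_pos).mono fun n hn => ⟨(Real.exp_pos _).trans_le hn, Real.exp_pos _⟩, ?_⟩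
  rw [Metric.tendsto_nhds]
  intro ε hε
  filter_upwards [hlow (ε / 2) (half_pos hε), hup (ε / 2) (half_pos hε), eventually_gt_atTop 0]
    with n h1 h2 hn
  have hA : 0 < A n := (Real.exp_pos _).trans_le h1
  have hn' : (0 : ℝ) < n := Nat.cast_pos.2 hn
  have h3 := (Real.le_log_iff_exp_le hA).2 h1
  have h4 := (Real.log_le_iff_le_exp hA).2 h2
  rw [Real.dist_eq, sub_zero, Real.log_div hA.ne' (Real.exp_pos _).ne', Real.log_exp, abs_div,
    abs_of_pos hn', div_lt_iff₀ hn', abs_lt]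
  constructor <;> nlinarith

lemma ExpEq.symm {A B : ℕ → ℝ} (h : ExpEq A B) : ExpEq B A := by
  refine ⟨h.1.mono fun n hn => hn.symm, ?_⟩
  have := h.2.neg
  rw [neg_zero] at this
  refine this.congr fun n => ?_
  rw [← inv_div (A n), Real.log_inv, neg_div]

lemma ExpEq.trans {A B C : ℕ → ℝ} (h : ExpEq A B) (h' : ExpEq B C) : ExpEq A C := by
  refine ⟨(h.1.and h'.1).mono fun n hn => ⟨hn.1.1, hn.2.2⟩, ?_⟩
  have := h.2.add h'.2
  rw [add_zero] at this
  refine this.congr' ?_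
  filter_upwards [h.1, h'.1] with n h1 h2
  rw [← add_div, ← Real.log_mul (div_pos h1.1 h1.2).ne' (div_pos h2.1 h2.2).ne',
    div_mul_div_cancel₀ h1.2.ne']

lemma ExpEq.congr {A B A' B' : ℕ → ℝ} (h : ExpEq A B) (hA : ∀ n, A n = A' n)
    (hB : ∀ n, B n = B' n) : ExpEq A' B' := by
  rwa [← funext hA, ← funext hB]

lemma ExpEq.rpow {A B : ℕ → ℝ} (h : ExpEq A B) (p : ℝ) :
    ExpEq (fun n => A n ^ p) fun n => B n ^ p := by
  refine ⟨h.1.mono fun n hn => ⟨Real.rpow_pos_of_pos hn.1 p, Real.rpow_pos_of_pos hn.2 p⟩, ?_⟩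
  have := h.2.const_mul p
  rw [mul_zero] at this
  refine this.congr' ?_
  filter_upwards [h.1] with n hn
  rw [← Real.div_rpow hn.1.le hn.2.le, Real.log_rpow (div_pos hn.1 hn.2), mul_div_assoc]

/-- Removes the conditioning on `X ∈ Ω` in the compression cost. -/
lemma ExpEq.div_of_tendsto_one {A B p : ℕ → ℝ} (h : ExpEq A B) (hp : Tendsto p atTop (𝓝 1)) :
    ExpEq (fun n => A n / p n) B := by
  have hpos : ∀ᶠ n in atTop, 0 < p n := hp.eventually_const_lt one_pos
  refine ⟨(h.1.and hpos).mono fun n hn => ⟨div_pos hn.1.1 hn.2, hn.1.2⟩, ?_⟩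
  have h1 : Tendsto (fun n => Real.log (p n)) atTop (𝓝 0) := by
    simpa using hp.log one_ne_zero
  have := h.2.sub (h1.div_atTop tendsto_natCast_atTop_atTop)
  rw [sub_zero] at this
  refine this.congr' ?_
  filter_upwards [h.1, hpos] with n hn hpn
  rw [← sub_div, ← Real.log_div (div_pos hn.1 hn.2).ne' hpn.ne', div_right_comm]

/-- The exponent of a sequence of regions squeezed between two slabs. -/
theorem expEq_sumOn_of_slab {J : Type*} [Fintype J] {w : X → ℝ} {f : J → X → ℝ} {a : J → ℝ}
    (hw : ∀ x, 0 < w x) {R : X → ℝ} (hR : R ∈ stdSimplex ℝ X) (hs : ∀ j, mean R (f j) < a j)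
    {S : ∀ n : ℕ, Set (Fin n → X)} {K : ℝ} (hup : ∀ᶠ n in atTop, S n ⊆ slab f a n K)
    (hlow : ∀ δ : ℝ, 0 < δ → ∀ᶠ n : ℕ in atTop, slab f a n (-(n * δ)) ⊆ S n) :
    ExpEq (fun n => sumOn (S n) (iid w))
      fun n => Real.exp (-(n * (minKL w (feasible f a)).toReal)) := by
  obtain ⟨Q, -, eQ⟩ := exists_minKL_eq hw (isCompact_feasible f a)
    (minKL_ne_top_iff.2 ⟨R, hR, fun j => (hs j).le⟩)
  rw [eQ, EReal.toReal_coe]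
  have hiid : ∀ {n : ℕ} (x : Fin n → X), 0 ≤ iid w x := iid_nonneg fun x => (hw x).le
  refine expEq_of_bounds (fun ε hε => ?_) fun ε hε => ?_
  · obtain ⟨T, hT, hTs, hlt⟩ := exists_strict_kl_lt hw hR hs (m := kl Q w + ε)
      (by rw [eQ]; exact EReal.coe_lt_coe_iff.2 (by linarith))
    obtain ⟨δ, hδ, hev⟩ := eventually_exp_le_sumOn_slab hw hT hTs hlt
    filter_upwards [hev, hlow δ hδ] with n h1 h2
    exact h1.trans (sumOn_subset h2 hiid)
  · filter_upwards [eventually_sumOn_slab_le_exp hw (M := kl Q w - ε) (f := f) (a := a)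
      (by rw [eQ]; exact EReal.coe_lt_coe_iff.2 (by linarith)) K, hup] with n h1 h2
    exact (sumOn_subset h2 hiid).trans h1

/-! ### A single constraint -/

lemma feasible_unit (f : X → ℝ) (a : ℝ) :
    feasible (fun _ : Unit => f) (fun _ => a) = {Q | Q ∈ stdSimplex ℝ X ∧ mean Q f ≤ a} := by
  ext Q; simp [feasible]

omit [Fintype X] in
lemma slab_unit (f : X → ℝ) (a : ℝ) (n : ℕ) (s : ℝ) :
    slab (fun _ : Unit => f) (fun _ => a) n s = {x | ∑ i, f (x i) ≤ n * a + s} := by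
  ext x; simp [slab]

lemma iInf_le_mean {Q : X → ℝ} (hQ : Q ∈ stdSimplex ℝ X) (f : X → ℝ) : ⨅ x, f x ≤ mean Q f := by
  have : ⨅ x, f x = ∑ y, Q y * ⨅ x, f x := by rw [← Finset.sum_mul, hQ.2, one_mul]
  rw [this]
  exact Finset.sum_le_sum fun y _ =>
    mul_le_mul_of_nonneg_left (ciInf_le (Set.finite_range f).bddBelow y) (hQ.1 y)

lemma exists_mean_eq (f : X → ℝ) (x : X) : ∃ Q ∈ stdSimplex ℝ X, mean Q f = f x := by
  classical
  exact ⟨Pi.single x 1, single_mem_stdSimplex ℝ x, by simp [mean, Pi.single_apply]⟩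

lemma minKL_single_ne_top_iff [Nonempty X] (P f : X → ℝ) (a : ℝ) :
    minKL P {Q | Q ∈ stdSimplex ℝ X ∧ mean Q f ≤ a} ≠ ⊤ ↔ ⨅ x, f x ≤ a := by
  rw [minKL_ne_top_iff]
  constructor
  · rintro ⟨Q, hQ, h⟩
    exact (iInf_le_mean hQ f).trans h
  · intro h
    obtain ⟨x, hx⟩ := exists_eq_ciInf_of_finite (f := f)
    obtain ⟨Q, hQ, he⟩ := exists_mean_eq f x
    exact ⟨Q, hQ, by rw [he, hx]; exact h⟩

lemma slab_unit_eventually_eq_empty [Nonempty X] {f : X → ℝ} {a : ℝ} (h : a < ⨅ x, f x) (K : ℝ) :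
    ∀ᶠ n : ℕ in atTop, slab (fun _ : Unit => f) (fun _ => a) n K = ∅ := by
  filter_upwards [eventually_le_natCast_mul (K + 1) (sub_pos.2 h)] with n hn
  rw [slab_unit, Set.eq_empty_iff_forall_notMem]
  intro x hx
  have h1 : (n : ℝ) * ⨅ x, f x ≤ ∑ i, f (x i) := by
    have := Finset.sum_le_sum fun (i : Fin n) (_ : i ∈ Finset.univ) =>
      ciInf_le (Set.finite_range f).bddBelow (x i)
    simpa using this
  simp only [Set.mem_ofPred_eq] at hx
  linarith

/-- Over all distributions, the values of `levelKL` above the infimum are the non-zero ones. -/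
lemma iInf_levelKL_lt_iff {P g : X → ℝ} (hP : ∀ x, 0 < P x) (hPs : P ∈ stdSimplex ℝ X)
    {c : EReal} : (⨅ v, levelKL P g (stdSimplex ℝ X) v) < c ↔ 0 < c := by
  have : ⨅ v, levelKL P g (stdSimplex ℝ X) v = 0 := by
    refine le_antisymm ?_ (le_iInf fun v => minKL_nonneg hP hPs fun _ h => h.1)
    simpa [kl_self hP] using iInf_levelKL_le (g := g) (P := P) hPs
  rw [this]

lemma levelKL_ne_zero_iff {P g : X → ℝ} (hP : ∀ x, 0 < P x) (hPs : P ∈ stdSimplex ℝ X) {u : ℝ} :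
    levelKL P g (stdSimplex ℝ X) u ≠ 0 ↔ u < mean P g := by
  rw [levelKL, ne_eq, minKL_eq_zero_iff hP hPs (fun _ h => h.1)
    (isCompact_level (isCompact_stdSimplex ℝ X) u)]
  simp [hPs]

lemma strictAntiOn_levelKL_stdSimplex {P g : X → ℝ} (hP : ∀ x, 0 < P x)
    (hPs : P ∈ stdSimplex ℝ X) :
    StrictAntiOn (levelKL P g (stdSimplex ℝ X))
      {u | levelKL P g (stdSimplex ℝ X) u ≠ 0 ∧ levelKL P g (stdSimplex ℝ X) u ≠ ⊤} := by
  refine (strictAntiOn_levelKL hP subset_rfl (isCompact_stdSimplex ℝ X)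
    (convex_stdSimplex ℝ X)).mono fun u hu => ⟨?_, hu.2⟩
  rw [iInf_levelKL_lt_iff hP hPs]
  exact lt_of_le_of_ne (minKL_nonneg hP hPs fun _ h => h.1) hu.1.symm

lemma existsUnique_levelKL_stdSimplex_eq {P g : X → ℝ} (hP : ∀ x, 0 < P x)
    (hPs : P ∈ stdSimplex ℝ X) {E : ℝ} (hE : 0 < E)
    (hs : ∃ s, (E : EReal) ≤ levelKL P g (stdSimplex ℝ X) s ∧
      levelKL P g (stdSimplex ℝ X) s ≠ ⊤) :
    ∃! u, levelKL P g (stdSimplex ℝ X) u = E :=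
  existsUnique_levelKL_eq hP subset_rfl (isCompact_stdSimplex ℝ X) (convex_stdSimplex ℝ X)
    ((iInf_levelKL_lt_iff hP hPs).2 (EReal.coe_pos.2 hE)) hs

/-- The unique minimizer under a single constraint. -/
lemma exists_minimizer_single {P g : X → ℝ} (hP : ∀ x, 0 < P x) {a : ℝ} (h : ∃ x, g x < a) :
    ∃ l : ℝ, 0 ≤ l ∧ ∀ Q : X → ℝ, IsMinimizer P {Q | Q ∈ stdSimplex ℝ X ∧ mean Q g ≤ a} Q ↔
      Q = normalize fun x => P x * Real.exp (-(l * g x)) := by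
  obtain ⟨x, hx⟩ := h
  have : Nonempty X := ⟨x⟩
  obtain ⟨R, hR, he⟩ := exists_mean_eq g x
  obtain ⟨l, hl, hmem, -, hmin⟩ := exists_multipliers hP hR (J := Unit) (f := fun _ => g)
    (a := fun _ => a) fun _ => he ▸ hx
  refine ⟨l (), hl (), fun Q => ?_⟩
  rw [← feasible_unit, isMinimizer_iff_of_multipliers (normalize_pos (tilt_pos hP l)) hmem hmin]
  -- The constraint level contributes only a constant factor, which normalization cancels.
  have : tilt P (fun _ : Unit => g) (fun _ => a) l =
      fun x => Real.exp (l () * a) * (P x * Real.exp (-(l () * g x))) := by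
    funext y
    simp only [tilt, Finset.univ_unique, Finset.sum_singleton]
    rw [mul_left_comm, ← Real.exp_add]
    congr 2
    simp only [PUnit.default_eq_unit]
    ring
  rw [this, normalize_const_mul (Real.exp_pos _).ne']

/-! ### The decision regions -/

section Regions

variable {P0 P1 : X → ℝ} {θ : ℝ}

omit [Fintype X] in
lemma mem_omegaHat_iff (hpos0 : ∀ x, 0 < P0 x) (hpos1 : ∀ x, 0 < P1 x) (hθ : 0 < θ) {α β : ℝ}
    {n : ℕ} {x : Fin n → X} :
    x ∈ omegaHat P0 P1 θ α β n ↔ -Real.log (iid P1 x) ≤ n * β * (1 + 1 / θ) ∧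
      n * α + Real.log (iid P0 x) ≤ n * β + Real.log (iid P1 x) := by
  have h0 := iid_pos hpos0 x
  have h1 := iid_pos hpos1 x
  simp only [omegaHat, Set.mem_ofPred_eq, max_le_iff]
  rw [← Real.log_le_log_iff (Real.rpow_pos_of_pos h1 _) (mul_pos (Real.exp_pos _) h1),
    ← Real.log_le_log_iff (mul_pos (Real.exp_pos _) h0) (mul_pos (Real.exp_pos _) h1),
    Real.log_rpow h1, Real.log_mul (Real.exp_pos _).ne' h1.ne',
    Real.log_mul (Real.exp_pos _).ne' h0.ne', Real.log_exp, Real.log_exp]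
  refine and_congr_left fun _ => ?_
  rw [div_mul_eq_mul_div, one_mul, div_le_iff₀ (by linarith), one_add_div hθ.ne', ← mul_div_assoc,
    le_div_iff₀ hθ]
  constructor <;> intro h <;> linarith

omit [Fintype X] in
lemma omegaStar_subset_omegaHat (hpos0 : ∀ x, 0 < P0 x) (hpos1 : ∀ x, 0 < P1 x) {α β : ℝ} {n : ℕ} :
    omegaStar P0 P1 θ α β n ⊆ omegaHat P0 P1 θ α β n := fun x hx => by
  have h1 := Real.rpow_pos_of_pos (iid_pos hpos1 x) (1 / (1 + θ))
  have h2 := mul_pos (Real.exp_pos (n * α)) (iid_pos hpos0 x)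
  simp only [omegaStar, omegaHat, Set.mem_ofPred_eq] at hx ⊢
  exact max_le (by linarith) (by linarith)

omit [Fintype X] in
-- It is enough that each summand is at most half of the right-hand side. The factor `2` shifts the
-- two log thresholds by amounts independent of `n`, which is why the two regions share their
-- exponents.
lemma mem_omegaStar_of_le (hpos0 : ∀ x, 0 < P0 x) (hpos1 : ∀ x, 0 < P1 x) (hθ : 0 < θ) {α β : ℝ}
    {n : ℕ} {x : Fin n → X}
    (h1 : -Real.log (iid P1 x) ≤ n * β * (1 + 1 / θ) - (1 + 1 / θ) * Real.log 2)
    (h2 : n * α + Real.log (iid P0 x) ≤ n * β + Real.log (iid P1 x) - Real.log 2) :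
    x ∈ omegaStar P0 P1 θ α β n := by
  have h0 := iid_pos hpos0 x
  have h1' := iid_pos hpos1 x
  have e1 : 2 * iid P1 x ^ (1 / (1 + θ)) ≤ Real.exp (n * β) * iid P1 x := by
    rw [← Real.log_le_log_iff (mul_pos two_pos (Real.rpow_pos_of_pos h1' _))
      (mul_pos (Real.exp_pos _) h1'), Real.log_mul two_ne_zero (Real.rpow_pos_of_pos h1' _).ne',
      Real.log_rpow h1', Real.log_mul (Real.exp_pos _).ne' h1'.ne', Real.log_exp]
    have h3 : 1 / (1 + θ) * Real.log (iid P1 x) ≤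
        n * β + Real.log (iid P1 x) - Real.log 2 := by
      rw [div_mul_eq_mul_div, one_mul, div_le_iff₀ (by linarith)]
      have h4 : θ * -Real.log (iid P1 x) ≤ θ * (n * β * (1 + 1 / θ) - (1 + 1 / θ) * Real.log 2) :=
        mul_le_mul_of_nonneg_left h1 hθ.le
      have h5 : θ * (n * β * (1 + 1 / θ) - (1 + 1 / θ) * Real.log 2) =
          (n * β - Real.log 2) * (1 + θ) := by
        field_simp; ring
      linarith
    linarith
  have e2 : 2 * (Real.exp (n * α) * iid P0 x) ≤ Real.exp (n * β) * iid P1 x := by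
    rw [← Real.log_le_log_iff (mul_pos two_pos (mul_pos (Real.exp_pos _) h0))
      (mul_pos (Real.exp_pos _) h1'), Real.log_mul two_ne_zero (mul_pos (Real.exp_pos _) h0).ne',
      Real.log_mul (Real.exp_pos _).ne' h0.ne',
      Real.log_mul (Real.exp_pos _).ne' h1'.ne', Real.log_exp, Real.log_exp]
    linarith
  simp only [omegaStar, Set.mem_ofPred_eq]
  linarith

omit [Fintype X] in
lemma sum_log_div {P Q : X → ℝ} (hP : ∀ x, 0 < P x) (hQ : ∀ x, 0 < Q x) {n : ℕ}
    (x : Fin n → X) :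
    ∑ i, Real.log (P (x i) / Q (x i)) = Real.log (iid P x) - Real.log (iid Q x) := by
  rw [log_iid hP, log_iid hQ, ← Finset.sum_sub_distrib]
  exact Finset.sum_congr rfl fun i _ => Real.log_div (hP _).ne' (hQ _).ne'

lemma mean_log_div_comm (Q P0 P1 : X → ℝ) :
    (mean Q fun x => Real.log (P0 x / P1 x)) = -mean Q fun x => Real.log (P1 x / P0 x) := by
  rw [← mean_neg]
  congr 1
  funext x
  rw [← inv_div, Real.log_inv]

/-- The two functions constrained in the false-alarm problem. -/
noncomputable def faFun (P0 P1 : X → ℝ) : Fin 2 → X → ℝ :=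
  ![fun x => -Real.log (P1 x), fun x => Real.log (P0 x / P1 x)]

/-- The two constraint levels of the false-alarm problem. -/
noncomputable def faLevel (θ α β : ℝ) : Fin 2 → ℝ := ![β * (1 + 1 / θ), β - α]

lemma setFA_eq_feasible (α β : ℝ) :
    setFA P0 P1 θ α β = feasible (faFun P0 P1) (faLevel θ α β) := by
  ext Q
  simp [setFA, feasible, faFun, faLevel, Fin.forall_fin_two, mean_neg]

lemma setC_eq_feasible (α β : ℝ) :
    setC P0 P1 θ α β = feasible (faFun P0 P1) (faLevel θ α β) := by
  rw [← setFA_eq_feasible]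
  ext Q
  simp only [setC, setFA, Set.mem_ofPred_eq, mean_log_div_comm Q P0 P1]
  refine and_congr_right fun _ => and_congr ?_ ?_ <;> constructor <;> intro h <;> linarith

lemma StrictlyFeasible.exists_slater {α β : ℝ} (h : StrictlyFeasible P0 P1 θ α β) :
    ∃ R ∈ stdSimplex ℝ X, ∀ j, mean R (faFun P0 P1 j) < faLevel θ α β j := by
  obtain ⟨R, hR, h1, h2⟩ := h
  refine ⟨R, hR, Fin.forall_fin_two.2 ⟨?_, ?_⟩⟩
  · simp only [faFun, faLevel, Matrix.cons_val_zero, mean_neg]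
    linarith
  · simp only [faFun, faLevel, Matrix.cons_val_one, Matrix.cons_val_fin_one,
      mean_log_div_comm R P0 P1]
    linarith

omit [Fintype X] in
lemma omegaHat_eq_slab (hpos0 : ∀ x, 0 < P0 x) (hpos1 : ∀ x, 0 < P1 x) (hθ : 0 < θ) (α β : ℝ)
    (n : ℕ) : omegaHat P0 P1 θ α β n = slab (faFun P0 P1) (faLevel θ α β) n 0 := by
  ext x
  rw [mem_omegaHat_iff hpos0 hpos1 hθ]
  simp only [slab, faFun, faLevel, Fin.forall_fin_two, Set.mem_ofPred_eq, Matrix.cons_val_zero,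
    Matrix.cons_val_one, Matrix.cons_val_fin_one, Finset.sum_neg_distrib, ← log_iid hpos1,
    sum_log_div hpos0 hpos1]
  refine and_congr ?_ ?_ <;> constructor <;> intro h <;> linarith

omit [Fintype X] in
lemma slab_subset_omegaStar (hpos0 : ∀ x, 0 < P0 x) (hpos1 : ∀ x, 0 < P1 x) (hθ : 0 < θ)
    {α β : ℝ} {n : ℕ} {s : ℝ} (hs : (1 + 1 / θ) * Real.log 2 ≤ s) :
    slab (faFun P0 P1) (faLevel θ α β) n (-s) ⊆ omegaStar P0 P1 θ α β n := by
  intro x hx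
  simp only [slab, faFun, faLevel, Fin.forall_fin_two, Set.mem_ofPred_eq, Matrix.cons_val_zero,
    Matrix.cons_val_one, Matrix.cons_val_fin_one, Finset.sum_neg_distrib, ← log_iid hpos1,
    sum_log_div hpos0 hpos1] at hx
  have h2 : Real.log 2 ≤ (1 + 1 / θ) * Real.log 2 :=
    le_mul_of_one_le_left (Real.log_pos one_lt_two).le (by
      have := one_div_pos.2 hθ
      linarith)
  exact mem_omegaStar_of_le hpos0 hpos1 hθ (by linarith) (by linarith)

/-- The exponents of sums over the two decision regions. -/
lemma expEq_sumOn_omega (hpos0 : ∀ x, 0 < P0 x) (hpos1 : ∀ x, 0 < P1 x) (hθ : 0 < θ) {α β : ℝ}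
    (h : StrictlyFeasible P0 P1 θ α β) {w : X → ℝ} (hw : ∀ x, 0 < w x) :
    ExpEq (fun n => sumOn (omegaStar P0 P1 θ α β n) (iid w))
      (fun n => Real.exp (-(n * (minKL w (setFA P0 P1 θ α β)).toReal))) ∧
    ExpEq (fun n => sumOn (omegaHat P0 P1 θ α β n) (iid w))
      (fun n => Real.exp (-(n * (minKL w (setFA P0 P1 θ α β)).toReal))) := by
  obtain ⟨R, hR, hs⟩ := h.exists_slater
  have hlow : ∀ δ : ℝ, 0 < δ → ∀ᶠ n : ℕ in atTop,
      slab (faFun P0 P1) (faLevel θ α β) n (-(n * δ)) ⊆ omegaStar P0 P1 θ α β n := fun δ hδ =>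
    (eventually_le_natCast_mul _ hδ).mono fun n hn => slab_subset_omegaStar hpos0 hpos1 hθ hn
  have hup : ∀ n, omegaHat P0 P1 θ α β n ⊆ slab (faFun P0 P1) (faLevel θ α β) n 0 := fun n =>
    (omegaHat_eq_slab hpos0 hpos1 hθ α β n).le
  rw [setFA_eq_feasible]
  exact ⟨expEq_sumOn_of_slab hw hR hs (K := 0) (Eventually.of_forall fun n =>
      (omegaStar_subset_omegaHat hpos0 hpos1).trans (hup n)) hlow,
    expEq_sumOn_of_slab hw hR hs (K := 0) (Eventually.of_forall hup) fun δ hδ =>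
      (hlow δ hδ).mono fun n hn => hn.trans (omegaStar_subset_omegaHat hpos0 hpos1)⟩

/-! ### Misdetection -/

lemma setMD_eq_union (α β : ℝ) :
    setMD P0 P1 θ α β = set1 P1 θ β ∪ set2 P0 P1 (α - β) := by
  ext Q
  simp [setMD, set1, set2, and_or_left]

lemma eMD_eq_min (α β : ℝ) :
    eMD P0 P1 θ α β = min (e1 P1 θ β) (e2 P0 P1 (α - β)) := by
  rw [eMD, setMD_eq_union, minKL_union]
  rfl

omit [Fintype X] in
lemma omegaStar_compl_subset (hpos0 : ∀ x, 0 < P0 x) (hpos1 : ∀ x, 0 < P1 x) (hθ : 0 < θ)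
    (α β : ℝ) (n : ℕ) :
    (omegaStar P0 P1 θ α β n)ᶜ ⊆
      slab (fun _ : Unit => fun x => Real.log (P1 x)) (fun _ => -β * (1 + 1 / θ)) n
        ((1 + 1 / θ) * Real.log 2) ∪
      slab (fun _ : Unit => fun x => Real.log (P1 x / P0 x)) (fun _ => α - β) n (Real.log 2) := by
  intro x hx
  by_contra hcon
  rw [Set.mem_union, not_or, slab_unit, slab_unit] at hcon
  simp only [Set.mem_ofPred_eq, not_le, ← log_iid hpos1, sum_log_div hpos1 hpos0] at hcon
  exact hx (mem_omegaStar_of_le hpos0 hpos1 hθ (by linarith [hcon.1]) (by linarith [hcon.2]))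

omit [Fintype X] in
-- The complement is given by strict inequalities, hence a positive margin `s`.
lemma slab_subset_omegaHat_compl (hpos0 : ∀ x, 0 < P0 x) (hpos1 : ∀ x, 0 < P1 x) (hθ : 0 < θ)
    (α β : ℝ) {n : ℕ} {s : ℝ} (hs : 0 < s) :
    slab (fun _ : Unit => fun x => Real.log (P1 x)) (fun _ => -β * (1 + 1 / θ)) n (-s) ⊆
      (omegaHat P0 P1 θ α β n)ᶜ ∧
    slab (fun _ : Unit => fun x => Real.log (P1 x / P0 x)) (fun _ => α - β) n (-s) ⊆
      (omegaHat P0 P1 θ α β n)ᶜ := by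
  constructor <;> intro x hx h <;> rw [mem_omegaHat_iff hpos0 hpos1 hθ] at h <;>
    simp only [slab_unit, Set.mem_ofPred_eq, ← log_iid hpos1, sum_log_div hpos1 hpos0] at hx
  · linarith [h.1]
  · linarith [h.2]

lemma eventually_prob_omegaStar_compl_le (hpos0 : ∀ x, 0 < P0 x) (hpos1 : ∀ x, 0 < P1 x)
    (hθ : 0 < θ) {α β M : ℝ} (hM : (M : EReal) < eMD P0 P1 θ α β) :
    ∀ᶠ n : ℕ in atTop, prob P1 (omegaStar P0 P1 θ α β n)ᶜ ≤ Real.exp (-(n * M)) := by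
  -- The gap between `M` and `M'` absorbs the factor `2` from the union bound.
  obtain ⟨M', hMM', hM'⟩ := EReal.exists_between_coe_real hM
  rw [eMD_eq_min, lt_min_iff, e1, e2, set1, set2, ← feasible_unit, ← feasible_unit] at hM'
  filter_upwards [eventually_sumOn_slab_le_exp hpos1 hM'.1 ((1 + 1 / θ) * Real.log 2),
    eventually_sumOn_slab_le_exp hpos1 hM'.2 (Real.log 2),
    eventually_exp_neg_mul_le (sub_pos.2 (EReal.coe_lt_coe_iff.1 hMM'))
      (show (0 : ℝ) < 1 / 2 by norm_num)] with n h1 h2 h3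
  have hiid : ∀ x : Fin n → X, 0 ≤ iid P1 x := iid_nonneg fun x => (hpos1 x).le
  have h4 := sumOn_subset (omegaStar_compl_subset hpos0 hpos1 hθ α β n) hiid
  rw [Set.union_eq_iUnion] at h4
  have h5 := h4.trans (sumOn_iUnion_le _ hiid)
  rw [Fintype.sum_bool] at h5
  simp only [cond_true, cond_false] at h5
  calc prob P1 (omegaStar P0 P1 θ α β n)ᶜ ≤ 2 * Real.exp (-(n * M')) := by
        rw [prob]; linarith
    _ = 2 * Real.exp (-(n * (M' - M))) * Real.exp (-(n * M)) := by
        rw [mul_assoc, ← Real.exp_add]; ring_nf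
    _ ≤ 1 * Real.exp (-(n * M)) :=
        mul_le_mul_of_nonneg_right (by linarith) (Real.exp_pos _).le
    _ = _ := one_mul _

/-- A finite minimum forces `a` to be at least the least value of `f`. Excluding equality is exactly
Slater's condition, met by a point mass. -/
lemma eventually_exp_le_sumOn_single [Nonempty X] {w f : X → ℝ} (hw : ∀ x, 0 < w x) {a m : ℝ}
    (ha : a ≠ ⨅ x, f x) (hm : minKL w {Q | Q ∈ stdSimplex ℝ X ∧ mean Q f ≤ a} < m) :
    ∃ δ : ℝ, 0 < δ ∧ ∀ᶠ n : ℕ in atTop, Real.exp (-(n * m)) ≤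
      sumOn (slab (fun _ : Unit => f) (fun _ => a) n (-(n * δ))) (iid w) := by
  have hlt : ⨅ x, f x < a := lt_of_le_of_ne
    ((minKL_single_ne_top_iff w f a).1 (hm.trans (EReal.coe_lt_top m)).ne) ha.symm
  obtain ⟨x, hx⟩ := exists_lt_of_ciInf_lt hlt
  obtain ⟨R, hR, he⟩ := exists_mean_eq f x
  rw [← feasible_unit] at hm
  obtain ⟨Q, hQ, hQs, hQm⟩ := exists_strict_kl_lt hw hR (fun _ => he ▸ hx) hm
  exact eventually_exp_le_sumOn_slab hw hQ hQs hQm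

lemma eventually_exp_le_prob_omegaHat_compl [Nonempty X] (hpos0 : ∀ x, 0 < P0 x)
    (hpos1 : ∀ x, 0 < P1 x) (hθ : 0 < θ) {α β m : ℝ}
    (h1 : -β * (1 + 1 / θ) ≠ ⨅ x, Real.log (P1 x)) (h2 : α - β ≠ ⨅ x, Real.log (P1 x / P0 x))
    (hm : eMD P0 P1 θ α β < m) :
    ∀ᶠ n : ℕ in atTop, Real.exp (-(n * m)) ≤ prob P1 (omegaHat P0 P1 θ α β n)ᶜ := by
  rw [eMD_eq_min, min_lt_iff] at hm
  have hiid : ∀ {n : ℕ} (x : Fin n → X), 0 ≤ iid P1 x := iid_nonneg fun x => (hpos1 x).le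
  rcases hm with hm | hm
  · obtain ⟨δ, hδ, hev⟩ := eventually_exp_le_sumOn_single hpos1 h1 hm
    filter_upwards [hev, eventually_gt_atTop 0] with n hn hn0
    exact hn.trans (sumOn_subset (slab_subset_omegaHat_compl hpos0 hpos1 hθ α β
      (mul_pos (Nat.cast_pos.2 hn0) hδ)).1 hiid)
  · obtain ⟨δ, hδ, hev⟩ := eventually_exp_le_sumOn_single hpos1 h2 hm
    filter_upwards [hev, eventually_gt_atTop 0] with n hn hn0
    exact hn.trans (sumOn_subset (slab_subset_omegaHat_compl hpos0 hpos1 hθ α β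
      (mul_pos (Nat.cast_pos.2 hn0) hδ)).2 hiid)

lemma misdetection_expEq [Nonempty X] (hpos0 : ∀ x, 0 < P0 x) (hpos1 : ∀ x, 0 < P1 x)
    (hP1 : P1 ∈ stdSimplex ℝ X) (hθ : 0 < θ) {α β : ℝ}
    (h1 : -β * (1 + 1 / θ) ≠ ⨅ x, Real.log (P1 x)) (h2 : α - β ≠ ⨅ x, Real.log (P1 x / P0 x))
    (hne : eMD P0 P1 θ α β ≠ ⊤) :
    ExpEq (fun n => prob P1 (omegaStar P0 P1 θ α β n)ᶜ)
      (fun n => Real.exp (-(n * (eMD P0 P1 θ α β).toReal))) ∧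
    ExpEq (fun n => prob P1 (omegaHat P0 P1 θ α β n)ᶜ)
      (fun n => Real.exp (-(n * (eMD P0 P1 θ α β).toReal))) := by
  have h0 : 0 ≤ eMD P0 P1 θ α β := minKL_nonneg hpos1 hP1 fun _ h => h.1
  have he : ((eMD P0 P1 θ α β).toReal : EReal) = eMD P0 P1 θ α β :=
    EReal.coe_toReal hne (ne_of_gt (EReal.bot_lt_zero.trans_le h0))
  have hiid : ∀ {n : ℕ} (x : Fin n → X), 0 ≤ iid P1 x := iid_nonneg fun x => (hpos1 x).le
  have hsub : ∀ n, prob P1 (omegaHat P0 P1 θ α β n)ᶜ ≤ prob P1 (omegaStar P0 P1 θ α β n)ᶜ :=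
    fun n => sumOn_subset (Set.compl_subset_compl.2 (omegaStar_subset_omegaHat hpos0 hpos1)) hiid
  have hlow : ∀ ε > 0, ∀ᶠ n : ℕ in atTop,
      Real.exp (-(n * ((eMD P0 P1 θ α β).toReal + ε))) ≤ prob P1 (omegaHat P0 P1 θ α β n)ᶜ :=
    fun ε hε => eventually_exp_le_prob_omegaHat_compl hpos0 hpos1 hθ h1 h2 (by
      conv_lhs => rw [← he]
      exact EReal.coe_lt_coe_iff.2 (by linarith))
  have hup : ∀ ε > 0, ∀ᶠ n : ℕ in atTop, prob P1 (omegaStar P0 P1 θ α β n)ᶜ ≤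
      Real.exp (-(n * ((eMD P0 P1 θ α β).toReal - ε))) :=
    fun ε hε => eventually_prob_omegaStar_compl_le hpos0 hpos1 hθ (by
      conv_rhs => rw [← he]
      exact EReal.coe_lt_coe_iff.2 (by linarith))
  -- The complement of `omegaHat` is the smaller one: its lower bound and the upper bound for the
  -- larger complement serve both.
  exact ⟨expEq_of_bounds (fun ε hε => (hlow ε hε).mono fun n hn => hn.trans (hsub n)) hup,
    expEq_of_bounds hlow fun ε hε => (hup ε hε).mono fun n hn => (hsub n).trans hn⟩

lemma eventually_compl_eq_empty [Nonempty X] (hpos0 : ∀ x, 0 < P0 x) (hpos1 : ∀ x, 0 < P1 x)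
    (hθ : 0 < θ) {α β : ℝ} (h : eMD P0 P1 θ α β = ⊤) : ∀ᶠ n in atTop,
      (omegaStar P0 P1 θ α β n)ᶜ = ∅ ∧ (omegaHat P0 P1 θ α β n)ᶜ = ∅ := by
  rw [eMD_eq_min, min_eq_top] at h
  have h1 : -β * (1 + 1 / θ) < ⨅ x, Real.log (P1 x) := lt_of_not_ge fun hle =>
    (minKL_single_ne_top_iff P1 _ _).2 hle h.1
  have h2 : α - β < ⨅ x, Real.log (P1 x / P0 x) := lt_of_not_ge fun hle =>
    (minKL_single_ne_top_iff P1 _ _).2 hle h.2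
  filter_upwards [slab_unit_eventually_eq_empty h1 ((1 + 1 / θ) * Real.log 2),
    slab_unit_eventually_eq_empty h2 (Real.log 2)] with n hn1 hn2
  have h3 := omegaStar_compl_subset hpos0 hpos1 hθ α β n
  rw [hn1, hn2, Set.union_empty, Set.subset_empty_iff] at h3
  exact ⟨h3, Set.subset_empty_iff.1 (h3 ▸ Set.compl_subset_compl.2
    (omegaStar_subset_omegaHat hpos0 hpos1))⟩

/-! ### False alarm -/

lemma exists_minimizer_setFA (hpos0 : ∀ x, 0 < P0 x) (hpos1 : ∀ x, 0 < P1 x) {α β : ℝ}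
    (h : StrictlyFeasible P0 P1 θ α β) :
    ∃ η ξ : ℝ, 0 ≤ η ∧ 0 ≤ ξ ∧ ∀ Q : X → ℝ, IsMinimizer P0 (setFA P0 P1 θ α β) Q ↔
      Q = normalize fun x => P0 x ^ (1 - η) * P1 x ^ (η + ξ) := by
  obtain ⟨R, hR, hs⟩ := h.exists_slater
  have : Nonempty X := by
    by_contra h
    rw [not_nonempty_iff] at h
    have := hR.2
    simp at this
  obtain ⟨l, hl, hmem, -, hmin⟩ := exists_multipliers hpos0 hR hs
  refine ⟨l 1, l 0, hl 1, hl 0, fun Q => ?_⟩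
  rw [setFA_eq_feasible, isMinimizer_iff_of_multipliers (normalize_pos (tilt_pos hpos0 l)) hmem
    hmin]
  have : tilt P0 (faFun P0 P1) (faLevel θ α β) l = fun x =>
      Real.exp (l 0 * faLevel θ α β 0 + l 1 * faLevel θ α β 1) *
        (P0 x ^ (1 - l 1) * P1 x ^ (l 1 + l 0)) := by
    funext x
    rw [tilt, Fin.sum_univ_two, Real.rpow_def_of_pos (hpos0 x), Real.rpow_def_of_pos (hpos1 x),
      ← Real.exp_add, ← Real.exp_add]
    conv_lhs => rw [← Real.exp_log (hpos0 x), ← Real.exp_add]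
    congr 1
    simp only [faFun, Matrix.cons_val_zero, Matrix.cons_val_one, Matrix.cons_val_fin_one,
      Real.log_div (hpos0 x).ne' (hpos1 x).ne']
    ring
  rw [this, normalize_const_mul (Real.exp_pos _).ne']

/-- The empirical distribution of a member would be feasible. The empty vector has none, hence `0 <
n`. -/
lemma omegaHat_eq_empty (hpos0 : ∀ x, 0 < P0 x) (hpos1 : ∀ x, 0 < P1 x) (hθ : 0 < θ) {α β : ℝ}
    (h : eFA P0 P1 θ α β = ⊤) {n : ℕ} (hn : 0 < n) : omegaHat P0 P1 θ α β n = ∅ := by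
  rw [Set.eq_empty_iff_forall_notMem]
  intro x hx
  rw [omegaHat_eq_slab hpos0 hpos1 hθ] at hx
  obtain ⟨Q, hQ, hm⟩ := exists_empirical hn x
  have hmem : Q ∈ setFA P0 P1 θ α β := by
    rw [setFA_eq_feasible]
    refine ⟨hQ, fun j => ?_⟩
    rw [hm, div_le_iff₀ (Nat.cast_pos.2 hn)]
    linarith [hx j]
  exact minKL_ne_top_iff.2 ⟨Q, hmem⟩ h

/-- With `α - β = t` fixed, the likelihood-ratio constraint no longer involves `β` and joins the
base set `K`. -/
lemma eFA_eq_levelKL (t β : ℝ) :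
    eFA P0 P1 θ (β + t) β = levelKL P0 (fun x => -Real.log (P1 x))
      {Q | Q ∈ stdSimplex ℝ X ∧ (mean Q fun x => Real.log (P0 x / P1 x)) ≤ -t}
      (β * (1 + 1 / θ)) := by
  rw [eFA, levelKL]
  congr 1
  ext Q
  simp only [setFA, Set.mem_ofPred_eq, mean_neg, sub_add_cancel_left]
  tauto

/-! ### Compression cost -/

omit [Fintype X] in
lemma iid_rpow (hpos1 : ∀ x, 0 < P1 x) (s : ℝ) {n : ℕ} (x : Fin n → X) :
    iid (fun y => P1 y ^ s) x = iid P1 x ^ s :=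
  Real.finsetProd_rpow _ _ (fun i _ => (hpos1 (x i)).le) s

lemma powerSum_eq (hpos1 : ∀ x, 0 < P1 x) {n : ℕ} (Ω : Set (Fin n → X)) :
    powerSum P1 θ Ω = sumOn Ω (iid fun x => P1 x ^ (1 / (1 + θ))) := by
  rw [powerSum]
  congr 1
  funext x
  rw [iid_rpow hpos1]

/-- The code length turns each term into `powerSum ^ θ * P1(x)^{1/(1+θ)}`, and summation supplies
one more factor `powerSum`. -/
lemma cost_eq (hpos1 : ∀ x, 0 < P1 x) (hθ : 0 < θ) {n : ℕ} (Ω : Set (Fin n → X)) :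
    cost P1 θ Ω = powerSum P1 θ Ω ^ (1 + θ) / prob P1 Ω := by
  rw [cost]
  congr 1
  rcases Ω.eq_empty_or_nonempty with rfl | ⟨y, hy⟩
  · have : (0 : ℝ) ^ (1 + θ) = 0 := Real.zero_rpow (by linarith)
    simp [sumOn, powerSum, this]
  · have hrp : ∀ x : Fin n → X, 0 < iid P1 x ^ (1 / (1 + θ)) := fun x =>
      Real.rpow_pos_of_pos (iid_pos hpos1 x) _
    have hPS : 0 < powerSum P1 θ Ω := by
      refine Finset.sum_pos' (fun x _ => Set.indicator_nonneg (fun z _ => (hrp z).le) x)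
        ⟨y, Finset.mem_univ y, ?_⟩
      rw [Set.indicator_of_mem hy]
      exact hrp y
    have key : ∀ x : Fin n → X, iid P1 x * Real.exp (θ * idealLength P1 θ Ω x) =
        powerSum P1 θ Ω ^ θ * iid P1 x ^ (1 / (1 + θ)) := by
      intro x
      have hx := iid_pos hpos1 x
      rw [idealLength, Real.log_div (hrp x).ne' hPS.ne', Real.log_rpow hx,
        Real.rpow_def_of_pos hPS, Real.rpow_def_of_pos hx, ← Real.exp_add]
      conv_lhs => rw [← Real.exp_log hx, ← Real.exp_add]
      congr 1
      rw [Real.log_exp]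
      have : 1 + θ ≠ 0 := by linarith
      field_simp
      ring
    simp only [key]
    have e : ∀ x, Ω.indicator (fun x => powerSum P1 θ Ω ^ θ * iid P1 x ^ (1 / (1 + θ))) x =
        powerSum P1 θ Ω ^ θ * Ω.indicator (fun x => iid P1 x ^ (1 / (1 + θ))) x := fun x => by
      by_cases hx : x ∈ Ω <;> simp [hx]
    rw [sumOn]
    simp only [e, ← Finset.mul_sum]
    rw [Real.rpow_add hPS, Real.rpow_one, mul_comm (powerSum P1 θ Ω)]
    rfl

/-- Turns the cost maximization into a minimal divergence from unnormalized weights, within reach of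
the slab theorem. -/
lemma entropy_sub_kl_eq (hpos1 : ∀ x, 0 < P1 x) (hθ : 0 < θ) (Q : X → ℝ) :
    θ * entropy Q - kl Q P1 = -(1 + θ) * kl Q fun x => P1 x ^ (1 / (1 + θ)) := by
  simp only [entropy, kl, Finset.mul_sum, ← Finset.sum_sub_distrib]
  refine Finset.sum_congr rfl fun x _ => ?_
  rcases eq_or_ne (Q x) 0 with h | h
  · simp [h]
  · rw [Real.log_div h (hpos1 x).ne', Real.log_div h (Real.rpow_pos_of_pos (hpos1 x) _).ne',
      Real.log_rpow (hpos1 x), Real.negMulLog]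
    have : 1 + θ ≠ 0 := by linarith
    field_simp
    ring

lemma exists_isGreatest_cost_exponent (hpos0 : ∀ x, 0 < P0 x) (hpos1 : ∀ x, 0 < P1 x)
    (hθ : 0 < θ) {α β : ℝ} (h : StrictlyFeasible P0 P1 θ α β) : ∃ ec : ℝ,
      IsGreatest ((fun Q => θ * entropy Q - kl Q P1) '' setC P0 P1 θ α β) ec ∧
      ExpEq (fun n => powerSum P1 θ (omegaStar P0 P1 θ α β n) ^ (1 + θ))
        (fun n => Real.exp (n * ec)) ∧
      ExpEq (fun n => powerSum P1 θ (omegaHat P0 P1 θ α β n) ^ (1 + θ))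
        (fun n => Real.exp (n * ec)) := by
  have hw : ∀ x, 0 < P1 x ^ (1 / (1 + θ)) := fun x => Real.rpow_pos_of_pos (hpos1 x) _
  obtain ⟨R, hR, hs⟩ := h.exists_slater
  obtain ⟨Q, hQ, eQ⟩ := exists_minKL_eq hw (isCompact_feasible (faFun P0 P1) (faLevel θ α β))
    (minKL_ne_top_iff.2 ⟨R, hR, fun j => (hs j).le⟩)
  obtain ⟨hE1, hE2⟩ := expEq_sumOn_omega hpos0 hpos1 hθ h hw
  rw [setFA_eq_feasible, eQ, EReal.toReal_coe] at hE1 hE2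
  have hexp : ∀ n : ℕ, Real.exp (-(n * kl Q fun x => P1 x ^ (1 / (1 + θ)))) ^ (1 + θ) =
      Real.exp (n * (-(1 + θ) * kl Q fun x => P1 x ^ (1 / (1 + θ)))) := fun n => by
    rw [← Real.exp_mul]; ring_nf
  refine ⟨-(1 + θ) * kl Q fun x => P1 x ^ (1 / (1 + θ)), ⟨⟨Q, ?_, ?_⟩, ?_⟩,
    (hE1.rpow (1 + θ)).congr (fun n => by rw [powerSum_eq hpos1]) hexp,
    (hE2.rpow (1 + θ)).congr (fun n => by rw [powerSum_eq hpos1]) hexp⟩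
  · rwa [setC_eq_feasible]
  · exact entropy_sub_kl_eq hpos1 hθ Q
  · rintro _ ⟨T, hT, rfl⟩
    rw [setC_eq_feasible] at hT
    have h1 := minKL_le (P := fun x => P1 x ^ (1 / (1 + θ))) hT
    rw [eQ, EReal.coe_le_coe_iff] at h1
    simp only [entropy_sub_kl_eq hpos1 hθ]
    nlinarith

/-- The witness is `P1`: it has divergence zero, so a positive exponent excludes it from both
misdetection constraints. -/
lemma strictlyFeasible_of_eMD_pos (hpos1 : ∀ x, 0 < P1 x) (hP1 : P1 ∈ stdSimplex ℝ X) {α β : ℝ}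
    (h : 0 < eMD P0 P1 θ α β) : StrictlyFeasible P0 P1 θ α β := by
  have hn : P1 ∉ setMD P0 P1 θ α β := fun hm => by
    have := minKL_le (P := P1) hm
    rw [kl_self hpos1] at this
    exact this.not_gt h
  simp only [setMD, Set.mem_ofPred_eq, not_and, not_or, not_le] at hn
  exact ⟨P1, hP1, hn hP1⟩

lemma prob_le_one (hP1 : P1 ∈ stdSimplex ℝ X) {n : ℕ} (S : Set (Fin n → X)) : prob P1 S ≤ 1 := by
  have h1 := sumOn_add_compl S (iid P1)
  rw [sum_iid, hP1.2, one_pow] at h1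
  have h2 : 0 ≤ sumOn Sᶜ (iid P1) := Finset.sum_nonneg fun x _ =>
    Set.indicator_nonneg (fun y _ => iid_nonneg hP1.1 y) x
  rw [prob]
  linarith

lemma tendsto_prob_omega (hpos0 : ∀ x, 0 < P0 x) (hpos1 : ∀ x, 0 < P1 x)
    (hP1 : P1 ∈ stdSimplex ℝ X) (hθ : 0 < θ) {α β : ℝ} (h : 0 < eMD P0 P1 θ α β) :
    Tendsto (fun n => prob P1 (omegaStar P0 P1 θ α β n)) atTop (𝓝 1) ∧
    Tendsto (fun n => prob P1 (omegaHat P0 P1 θ α β n)) atTop (𝓝 1) := by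
  obtain ⟨M, hM0, hM⟩ := EReal.exists_between_coe_real h
  have hM0' : 0 < M := EReal.coe_pos.1 hM0
  have hlim : Tendsto (fun n : ℕ => 1 - Real.exp (-(n * M))) atTop (𝓝 1) := by
    simpa using (Real.tendsto_exp_neg_atTop_nhds_zero.comp
      (tendsto_natCast_atTop_atTop.atTop_mul_const hM0')).const_sub 1
  have hstar : ∀ᶠ n : ℕ in atTop,
      1 - Real.exp (-(n * M)) ≤ prob P1 (omegaStar P0 P1 θ α β n) := by
    filter_upwards [eventually_prob_omegaStar_compl_le hpos0 hpos1 hθ hM] with n hn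
    have h1 := sumOn_add_compl (omegaStar P0 P1 θ α β n) (iid P1)
    rw [sum_iid, hP1.2, one_pow] at h1
    rw [prob] at hn ⊢
    linarith
  refine ⟨tendsto_of_tendsto_of_tendsto_of_le_of_le' hlim tendsto_const_nhds hstar
    (Eventually.of_forall fun n => prob_le_one hP1 _),
    tendsto_of_tendsto_of_tendsto_of_le_of_le' hlim tendsto_const_nhds ?_
    (Eventually.of_forall fun n => prob_le_one hP1 _)⟩
  exact hstar.mono fun n hn => hn.trans
    (sumOn_subset (omegaStar_subset_omegaHat hpos0 hpos1) (iid_nonneg hP1.1))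

end Regions

/-! ### The exponents as functions of one threshold -/

section Thresholds

variable {P0 P1 : X → ℝ} {θ : ℝ}

lemma log_iInf [Nonempty X] (hpos1 : ∀ x, 0 < P1 x) :
    Real.log (⨅ x, P1 x) = ⨅ x, Real.log (P1 x) := by
  obtain ⟨x, hx⟩ := exists_eq_ciInf_of_finite (f := P1)
  rw [← hx]
  refine le_antisymm (le_ciInf fun y => Real.log_le_log (hpos1 x) ?_)
    (ciInf_le (Set.finite_range _).bddBelow x)
  rw [hx]
  exact ciInf_le (Set.finite_range _).bddBelow y

lemma neg_mul_lt_neg_mul (hθ : 0 < θ) {b b' : ℝ} (h : b < b') :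
    -b' * (1 + 1 / θ) < -b * (1 + 1 / θ) :=
  mul_lt_mul_of_pos_right (neg_lt_neg h) (by positivity)

lemma e1_ne_zero_and_ne_top_iff [Nonempty X] (hpos1 : ∀ x, 0 < P1 x)
    (hP1 : P1 ∈ stdSimplex ℝ X) (hθ : 0 < θ) (β : ℝ) :
    (e1 P1 θ β ≠ 0 ∧ e1 P1 θ β ≠ ⊤) ↔
      θ * entropy P1 / (1 + θ) < β ∧ β ≤ -(θ * Real.log (⨅ x, P1 x)) / (1 + θ) := by
  have hent : (mean P1 fun x => Real.log (P1 x)) = -entropy P1 := by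
    simp [mean, entropy, Real.negMulLog]
  have hc : -β * (1 + 1 / θ) = -(β * (1 + θ)) / θ := by field_simp; ring
  have h1 : 0 < 1 + θ := by linarith
  refine and_congr ?_ ?_
  · refine (levelKL_ne_zero_iff hpos1 hP1).trans ?_
    rw [hent, hc, div_lt_iff₀ hθ, div_lt_iff₀ h1]
    constructor <;> intro h <;> linarith
  · refine (minKL_single_ne_top_iff P1 _ _).trans ?_
    rw [← log_iInf hpos1, hc, le_div_iff₀ hθ, le_div_iff₀ h1]
    constructor <;> intro h <;> linarith

lemma e1_monotone (hθ : 0 < θ) : Monotone (e1 P1 θ) := fun _ _ h =>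
  levelKL_antitone (mul_le_mul_of_nonneg_right (neg_le_neg h) (by positivity))

lemma e1_convexOn (hpos1 : ∀ x, 0 < P1 x) :
    ConvexOn ℝ {β | e1 P1 θ β ≠ ⊤} fun β => (e1 P1 θ β).toReal := by
  have h := (convexOn_levelKL (g := fun x => Real.log (P1 x)) hpos1 subset_rfl
    (isCompact_stdSimplex ℝ X) (convex_stdSimplex ℝ X)).comp_linearMap
      (-(LinearMap.mulRight ℝ (1 + 1 / θ)))
  have e : ∀ β, (-(LinearMap.mulRight ℝ (1 + 1 / θ))) β = -β * (1 + 1 / θ) := fun β => by simp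
  have e' : ∀ β, levelKL P1 (fun x => Real.log (P1 x)) (stdSimplex ℝ X)
      ((-(LinearMap.mulRight ℝ (1 + 1 / θ))) β) = e1 P1 θ β := fun β => by rw [e]; rfl
  simpa only [Set.preimage_ofPred_eq, Function.comp_def, e'] using h

lemma e1_strictMonoOn (hpos1 : ∀ x, 0 < P1 x) (hP1 : P1 ∈ stdSimplex ℝ X) (hθ : 0 < θ) :
    StrictMonoOn (e1 P1 θ) {β | e1 P1 θ β ≠ 0 ∧ e1 P1 θ β ≠ ⊤} := fun _ hb _ hb' h =>
  strictAntiOn_levelKL_stdSimplex hpos1 hP1 hb' hb (neg_mul_lt_neg_mul hθ h)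

lemma e1_existsUnique (hpos1 : ∀ x, 0 < P1 x) (hP1 : P1 ∈ stdSimplex ℝ X) (hθ : 0 < θ) {E : ℝ}
    (hE : 0 < E) (h : ∃ β, (E : EReal) ≤ e1 P1 θ β ∧ e1 P1 θ β ≠ ⊤) :
    ∃! β, e1 P1 θ β = E := by
  have hc : (1 + 1 / θ) ≠ 0 := by positivity
  have hbij : Function.Bijective fun β : ℝ => -β * (1 + 1 / θ) :=
    ⟨fun b b' hb => neg_injective (mul_right_cancel₀ hc hb),
      fun u => ⟨-(u / (1 + 1 / θ)), by simp only [neg_neg]; exact div_mul_cancel₀ u hc⟩⟩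
  obtain ⟨β, hβ⟩ := h
  exact hbij.existsUnique_iff.1 (existsUnique_levelKL_stdSimplex_eq
    (g := fun x => Real.log (P1 x)) hpos1 hP1 hE ⟨_, hβ⟩)

lemma e2_ne_zero_and_ne_top_iff [Nonempty X] (hpos1 : ∀ x, 0 < P1 x)
    (hP1 : P1 ∈ stdSimplex ℝ X) (t : ℝ) :
    (e2 P0 P1 t ≠ 0 ∧ e2 P0 P1 t ≠ ⊤) ↔
      (⨅ x, Real.log (P1 x / P0 x)) ≤ t ∧ t < kl P1 P0 := by
  rw [and_comm]
  exact and_congr (minKL_single_ne_top_iff P1 _ _) (levelKL_ne_zero_iff hpos1 hP1)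

/-- Below `b`, monotonicity would force the value to be exactly `E`, against uniqueness of the
solution. -/
lemma le_e1_iff (hpos1 : ∀ x, 0 < P1 x) (hP1 : P1 ∈ stdSimplex ℝ X) (hθ : 0 < θ) {E b : ℝ}
    (hE : 0 < E) (hb : e1 P1 θ b = E) (β : ℝ) : (E : EReal) ≤ e1 P1 θ β ↔ b ≤ β := by
  constructor
  · intro h
    by_contra! hlt
    have heq : e1 P1 θ β = E := le_antisymm (hb ▸ e1_monotone hθ hlt.le) h
    exact hlt.ne ((e1_existsUnique hpos1 hP1 hθ hE ⟨b, hb.ge, hb ▸ EReal.coe_ne_top E⟩).unique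
      heq hb)
  · intro h
    exact hb ▸ e1_monotone hθ h

lemma le_e2_iff (hpos1 : ∀ x, 0 < P1 x) (hP1 : P1 ∈ stdSimplex ℝ X) {E t : ℝ}
    (hE : 0 < E) (ht : e2 P0 P1 t = E) (s : ℝ) : (E : EReal) ≤ e2 P0 P1 s ↔ s ≤ t := by
  constructor
  · intro h
    by_contra! hlt
    have heq : e2 P0 P1 s = E := le_antisymm (ht ▸ levelKL_antitone hlt.le) h
    exact hlt.ne' ((existsUnique_levelKL_stdSimplex_eq hpos1 hP1 hE
      ⟨t, ht.ge, ht.trans_ne (EReal.coe_ne_top E)⟩).unique heq ht)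
  · intro h
    exact ht ▸ levelKL_antitone h

lemma eFA_antitone (hθ : 0 < θ) (t : ℝ) : Antitone fun β => eFA P0 P1 θ (β + t) β := by
  intro b b' h
  simp only [eFA_eq_levelKL]
  exact levelKL_antitone (mul_le_mul_of_nonneg_right h (by positivity))

lemma iInf_eFA_eq (hθ : 0 < θ) (t : ℝ) :
    (⨅ b : ℝ, eFA P0 P1 θ (b + t) b) = ⨅ u, levelKL P0 (fun x => -Real.log (P1 x))
      {Q | Q ∈ stdSimplex ℝ X ∧ (mean Q fun x => Real.log (P0 x / P1 x)) ≤ -t} u := by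
  have hc : (1 + 1 / θ) ≠ 0 := by positivity
  simp only [eFA_eq_levelKL]
  exact Function.Surjective.iInf_comp (f := fun b : ℝ => b * (1 + 1 / θ))
    (fun u => ⟨u / (1 + 1 / θ), div_mul_cancel₀ u hc⟩) _

lemma convex_level (g : X → ℝ) (s : ℝ) :
    Convex ℝ {Q | Q ∈ stdSimplex ℝ X ∧ mean Q g ≤ s} := by
  rw [← feasible_unit]
  exact convex_feasible _ _

lemma eFA_strictAntiOn (hpos0 : ∀ x, 0 < P0 x) (hθ : 0 < θ) (t : ℝ) :
    StrictAntiOn (fun β => eFA P0 P1 θ (β + t) β)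
      {β | (⨅ b : ℝ, eFA P0 P1 θ (b + t) b) < eFA P0 P1 θ (β + t) β ∧
        eFA P0 P1 θ (β + t) β ≠ ⊤} := by
  rw [iInf_eFA_eq hθ]
  simp only [eFA_eq_levelKL]
  intro b hb b' hb' h
  exact strictAntiOn_levelKL hpos0 (fun _ h => h.1) (isCompact_level (isCompact_stdSimplex ℝ X) _)
    (convex_level _ _) hb hb' (mul_lt_mul_of_pos_right h (by positivity))

lemma eFA_existsUnique (hpos0 : ∀ x, 0 < P0 x) (hθ : 0 < θ) {t E : ℝ}
    (hE : (⨅ b : ℝ, eFA P0 P1 θ (b + t) b) < (E : EReal))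
    (h : ∃ β, (E : EReal) ≤ eFA P0 P1 θ (β + t) β ∧ eFA P0 P1 θ (β + t) β ≠ ⊤) :
    ∃! β, eFA P0 P1 θ (β + t) β = E := by
  rw [iInf_eFA_eq hθ] at hE
  simp only [eFA_eq_levelKL] at h ⊢
  have hc : (1 + 1 / θ) ≠ 0 := by positivity
  have hbij : Function.Bijective fun β : ℝ => β * (1 + 1 / θ) :=
    ⟨fun b b' hb => mul_right_cancel₀ hc hb,
      fun u => ⟨u / (1 + 1 / θ), div_mul_cancel₀ u hc⟩⟩
  obtain ⟨β, hβ⟩ := h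
  exact hbij.existsUnique_iff.1 (existsUnique_levelKL_eq hpos0 (fun _ h => h.1)
    (isCompact_level (isCompact_stdSimplex ℝ X) _) (convex_level _ _) hE ⟨_, hβ⟩)

/-- Only the Chernoff half is used, so neither strict feasibility nor a finite exponent is required.
-/
lemma eventually_prob_omegaStar_le (hpos0 : ∀ x, 0 < P0 x) (hpos1 : ∀ x, 0 < P1 x)
    (hθ : 0 < θ) {α β M : ℝ} (hM : (M : EReal) < eFA P0 P1 θ α β) :
    ∀ᶠ n : ℕ in atTop, prob P0 (omegaStar P0 P1 θ α β n) ≤ Real.exp (-(n * M)) := by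
  rw [eFA, setFA_eq_feasible] at hM
  filter_upwards [eventually_sumOn_slab_le_exp hpos0 hM 0] with n hn
  refine (sumOn_subset ?_ fun x => (iid_pos hpos0 x).le).trans hn
  rw [← omegaHat_eq_slab hpos0 hpos1 hθ]
  exact omegaStar_subset_omegaHat hpos0 hpos1

end Thresholds

end JointDetection

/-! ### Assembly of the theorem -/

open JointDetection in
theorem mainTheorem2 {X : Type*} [Fintype X] (P0 P1 : X → ℝ)
    (hP0 : P0 ∈ stdSimplex ℝ X) (hP1 : P1 ∈ stdSimplex ℝ X)
    (hpos0 : ∀ x, 0 < P0 x) (hpos1 : ∀ x, 0 < P1 x) (θ : ℝ) (hθ : 0 < θ) :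
    -- the logarithmic form of the approximating rule, and monotonicity of the regions in `α`
    (∀ (α β : ℝ) (n : ℕ), omegaHat P0 P1 θ α β n =
      {x : Fin n → X | -Real.log (iid P1 x) ≤ n * β * (1 + 1 / θ) ∧
        n * (α - β) ≤ Real.log (iid P1 x / iid P0 x)}) ∧
    (∀ (α α' β : ℝ) (n : ℕ), α ≤ α' →
      omegaStar P0 P1 θ α' β n ⊆ omegaStar P0 P1 θ α β n ∧
      omegaHat P0 P1 θ α' β n ⊆ omegaHat P0 P1 θ α β n) ∧
    -- every minimum is attained as soon as its constraint set is non-empty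
    (∀ β, e1 P1 θ β ≠ ⊤ → ∃ Q ∈ set1 P1 θ β, e1 P1 θ β = (kl Q P1 : ℝ)) ∧
    (∀ t, e2 P0 P1 t ≠ ⊤ → ∃ Q ∈ set2 P0 P1 t, e2 P0 P1 t = (kl Q P1 : ℝ)) ∧
    (∀ α β, eMD P0 P1 θ α β ≠ ⊤ →
      ∃ Q ∈ setMD P0 P1 θ α β, eMD P0 P1 θ α β = (kl Q P1 : ℝ)) ∧
    (∀ α β, eFA P0 P1 θ α β ≠ ⊤ →
      ∃ Q ∈ setFA P0 P1 θ α β, eFA P0 P1 θ α β = (kl Q P0 : ℝ)) ∧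
    -- misdetection
    (∀ α β, eMD P0 P1 θ α β = min (e1 P1 θ β) (e2 P0 P1 (α - β))) ∧
    (∀ α β, -β * (1 + 1 / θ) ≠ ⨅ x, Real.log (P1 x) →
      α - β ≠ ⨅ x, Real.log (P1 x / P0 x) →
      (eMD P0 P1 θ α β ≠ ⊤ →
        ExpEq (fun n => prob P1 (omegaStar P0 P1 θ α β n)ᶜ)
          (fun n => prob P1 (omegaHat P0 P1 θ α β n)ᶜ) ∧
        ExpEq (fun n => prob P1 (omegaHat P0 P1 θ α β n)ᶜ)
          (fun n => Real.exp (-(n * (eMD P0 P1 θ α β).toReal)))) ∧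
      (eMD P0 P1 θ α β = ⊤ → ∀ᶠ n in atTop,
        (omegaStar P0 P1 θ α β n)ᶜ = ∅ ∧ (omegaHat P0 P1 θ α β n)ᶜ = ∅)) ∧
    -- the minimizers for `e₁` and `e₂`
    (∀ β, (∃ x, Real.log (P1 x) < -β * (1 + 1 / θ)) →
      ∃ l : ℝ, l ≤ 1 ∧ ∀ Q : X → ℝ, IsMinimizer P1 (set1 P1 θ β) Q ↔
        Q = normalize (fun x => P1 x ^ l)) ∧
    (∀ t, (∃ x, Real.log (P1 x / P0 x) < t) →
      ∃ ν : ℝ, 0 ≤ ν ∧ ∀ Q : X → ℝ, IsMinimizer P1 (set2 P0 P1 t) Q ↔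
        Q = normalize (fun x => P0 x ^ ν * P1 x ^ (1 - ν))) ∧
    -- `e₁`: monotone, convex, range of non-trivial values, strict monotonicity, inverse
    Monotone (e1 P1 θ) ∧
    ConvexOn ℝ {β | e1 P1 θ β ≠ ⊤} (fun β => (e1 P1 θ β).toReal) ∧
    (∀ β, (e1 P1 θ β ≠ 0 ∧ e1 P1 θ β ≠ ⊤) ↔
      θ * entropy P1 / (1 + θ) < β ∧ β ≤ -(θ * Real.log (⨅ x, P1 x)) / (1 + θ)) ∧
    StrictMonoOn (e1 P1 θ) {β | e1 P1 θ β ≠ 0 ∧ e1 P1 θ β ≠ ⊤} ∧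
    (∀ E : ℝ, 0 < E → (∃ β, (E : EReal) ≤ e1 P1 θ β ∧ e1 P1 θ β ≠ ⊤) →
      ∃! β, e1 P1 θ β = E) ∧
    -- `e₂`: the same
    Antitone (e2 P0 P1) ∧
    ConvexOn ℝ {t | e2 P0 P1 t ≠ ⊤} (fun t => (e2 P0 P1 t).toReal) ∧
    (∀ t, (e2 P0 P1 t ≠ 0 ∧ e2 P0 P1 t ≠ ⊤) ↔
      (⨅ x, Real.log (P1 x / P0 x)) ≤ t ∧ t < kl P1 P0) ∧
    StrictAntiOn (e2 P0 P1) {t | e2 P0 P1 t ≠ 0 ∧ e2 P0 P1 t ≠ ⊤} ∧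
    (∀ E : ℝ, 0 < E → (∃ t, (E : EReal) ≤ e2 P0 P1 t ∧ e2 P0 P1 t ≠ ⊤) →
      ∃! t, e2 P0 P1 t = E) ∧
    -- false alarm
    (∀ α β, StrictlyFeasible P0 P1 θ α β →
      eFA P0 P1 θ α β ≠ ⊤ ∧
      ExpEq (fun n => prob P0 (omegaStar P0 P1 θ α β n))
        (fun n => prob P0 (omegaHat P0 P1 θ α β n)) ∧
      ExpEq (fun n => prob P0 (omegaHat P0 P1 θ α β n))
        (fun n => Real.exp (-(n * (eFA P0 P1 θ α β).toReal))) ∧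
      ∃ η ξ : ℝ, 0 ≤ η ∧ 0 ≤ ξ ∧ ∀ Q : X → ℝ, IsMinimizer P0 (setFA P0 P1 θ α β) Q ↔
        Q = normalize (fun x => P0 x ^ (1 - η) * P1 x ^ (η + ξ))) ∧
    (∀ α β, eFA P0 P1 θ α β = ⊤ → ∀ n : ℕ, 0 < n →
      omegaStar P0 P1 θ α β n = ∅ ∧ omegaHat P0 P1 θ α β n = ∅) ∧
    -- the false-alarm exponent as a function of `β` for a fixed value `t` of `α - β`
    (∀ t, Antitone (fun β => eFA P0 P1 θ (β + t) β) ∧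
      StrictAntiOn (fun β => eFA P0 P1 θ (β + t) β)
        {β | (⨅ b : ℝ, eFA P0 P1 θ (b + t) b) < eFA P0 P1 θ (β + t) β ∧
          eFA P0 P1 θ (β + t) β ≠ ⊤} ∧
      ∀ E : ℝ, (⨅ b : ℝ, eFA P0 P1 θ (b + t) b) < (E : EReal) →
        (∃ β, (E : EReal) ≤ eFA P0 P1 θ (β + t) β ∧ eFA P0 P1 θ (β + t) β ≠ ⊤) →
        ∃! β, eFA P0 P1 θ (β + t) β = E) ∧
    -- compression cost
    (∀ α β, StrictlyFeasible P0 P1 θ α β → ∃ ec : ℝ,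
      IsGreatest ((fun Q => θ * entropy Q - kl Q P1) '' setC P0 P1 θ α β) ec ∧
      ExpEq (fun n => powerSum P1 θ (omegaHat P0 P1 θ α β n) ^ (1 + θ))
        (fun n => Real.exp (n * ec))) ∧
    (∀ α β, 0 < eMD P0 P1 θ α β →
      StrictlyFeasible P0 P1 θ α β ∧
      ExpEq (fun n => cost P1 θ (omegaStar P0 P1 θ α β n))
        (fun n => cost P1 θ (omegaHat P0 P1 θ α β n)) ∧
      ExpEq (fun n => cost P1 θ (omegaStar P0 P1 θ α β n))
        (fun n => powerSum P1 θ (omegaHat P0 P1 θ α β n) ^ (1 + θ))) ∧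
    -- the choice of `α` and `β`: `b1`, `t`, `bF` are the inverses of `e₁`, `e₂` at `EMD`, and of
    -- the false-alarm exponent at `EFA`
    (∀ EMD EFA b1 t bF : ℝ, 0 < EMD → e1 P1 θ b1 = EMD → e2 P0 P1 t = EMD →
      eFA P0 P1 θ (bF + t) bF = EFA →
      (∀ α β, (EMD : EReal) ≤ eMD P0 P1 θ α β ↔ b1 ≤ β ∧ α - β ≤ t) ∧
      ((⨅ b : ℝ, eFA P0 P1 θ (b + t) b) < (EFA : EReal) → ∀ β,
        ((EFA : EReal) ≤ eFA P0 P1 θ (β + t) β ↔ β ≤ bF)) ∧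
      (b1 ≤ bF → ∀ α β, α = bF + t → β = bF →
        (EMD : EReal) ≤ eMD P0 P1 θ α β ∧ (EFA : EReal) ≤ eFA P0 P1 θ α β ∧
        ∀ ε : ℝ, 0 < ε → ∀ᶠ n : ℕ in atTop,
          prob P1 (omegaStar P0 P1 θ α β n)ᶜ ≤ Real.exp (-(n * (EMD - ε))) ∧
          prob P0 (omegaStar P0 P1 θ α β n) ≤ Real.exp (-(n * (EFA - ε))))) := by
  have : Nonempty X := by
    by_contra h
    rw [not_nonempty_iff] at h
    have := hP1.2
    simp at this
  have hK := isCompact_stdSimplex ℝ X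
  refine ⟨fun α β n => ?_, fun α α' β n h => ?_,
    fun β h => exists_minKL_eq hpos1 (isCompact_level hK _) h,
    fun t h => exists_minKL_eq hpos1 (isCompact_level hK _) h,
    fun α β h => exists_minKL_eq hpos1 ?_ h, fun α β h => exists_minKL_eq hpos0 ?_ h, eMD_eq_min,
    fun α β h1 h2 => ⟨fun hne => ?_, eventually_compl_eq_empty hpos0 hpos1 hθ⟩,
    fun β h => ?_, fun t h => ?_, e1_monotone hθ, e1_convexOn hpos1,
    e1_ne_zero_and_ne_top_iff hpos1 hP1 hθ, e1_strictMonoOn hpos1 hP1 hθ,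
    fun E hE h => e1_existsUnique hpos1 hP1 hθ hE h, levelKL_antitone,
    convexOn_levelKL hpos1 subset_rfl hK (convex_stdSimplex ℝ X),
    e2_ne_zero_and_ne_top_iff hpos1 hP1, strictAntiOn_levelKL_stdSimplex hpos1 hP1,
    fun E hE h => existsUnique_levelKL_stdSimplex_eq hpos1 hP1 hE h,
    fun α β h => ?_, fun α β h n hn => ?_,
    fun t => ⟨eFA_antitone hθ t, eFA_strictAntiOn hpos0 hθ t,
      fun E hE h => eFA_existsUnique hpos0 hθ hE h⟩,
    fun α β h => ?_, fun α β h => ?_, fun EMD EFA b1 t bF hE hb1 ht hbF => ⟨fun α β => ?_,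
      fun hinf β => ⟨fun h => ?_, fun h => hbF ▸ eFA_antitone hθ t h⟩,
      fun hb α β hα hβ => ?_⟩⟩
  · ext x
    rw [mem_omegaHat_iff hpos0 hpos1 hθ, Set.mem_ofPred_eq,
      Real.log_div (iid_pos hpos1 x).ne' (iid_pos hpos0 x).ne']
    refine and_congr_right fun _ => ?_
    constructor <;> intro h <;> linarith
  · have hexp : ∀ x : Fin n → X, Real.exp (n * α) * iid P0 x ≤ Real.exp (n * α') * iid P0 x :=
      fun x => mul_le_mul_of_nonneg_right
        (Real.exp_le_exp.2 (mul_le_mul_of_nonneg_left h n.cast_nonneg)) (iid_pos hpos0 x).le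
    constructor <;> intro x hx <;>
      simp only [omegaStar, omegaHat, Set.mem_ofPred_eq, max_le_iff] at hx ⊢
    · linarith [hexp x]
    · exact ⟨hx.1, (hexp x).trans hx.2⟩
  · rw [setMD_eq_union]
    exact (isCompact_level hK _).union (isCompact_level hK _)
  · rw [setFA_eq_feasible]
    exact isCompact_feasible _ _
  · obtain ⟨hS, hH⟩ := misdetection_expEq hpos0 hpos1 hP1 hθ h1 h2 hne
    exact ⟨hS.trans hH.symm, hH⟩
  · obtain ⟨l, hl, hmin⟩ := exists_minimizer_single hpos1 h
    -- Tilting `P1` by `exp (-l ln P1)` yields the power `P1 ^ (1 - l)`, so `l ≥ 0` becomes an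
    -- exponent at most `1`.
    refine ⟨1 - l, by linarith, fun Q => (hmin Q).trans ?_⟩
    have e : (fun x => P1 x * Real.exp (-(l * Real.log (P1 x)))) = fun x => P1 x ^ (1 - l) := by
      funext x
      rw [Real.rpow_def_of_pos (hpos1 x)]
      conv_lhs => rw [← Real.exp_log (hpos1 x), ← Real.exp_add, Real.log_exp]
      ring_nf
    rw [e]
  · obtain ⟨ν, hν, hmin⟩ := exists_minimizer_single hpos1 h
    refine ⟨ν, hν, fun Q => (hmin Q).trans ?_⟩
    have e : (fun x => P1 x * Real.exp (-(ν * Real.log (P1 x / P0 x)))) =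
        fun x => P0 x ^ ν * P1 x ^ (1 - ν) := by
      funext x
      rw [Real.rpow_def_of_pos (hpos1 x), Real.rpow_def_of_pos (hpos0 x), ← Real.exp_add,
        Real.log_div (hpos1 x).ne' (hpos0 x).ne']
      conv_lhs => rw [← Real.exp_log (hpos1 x), ← Real.exp_add, Real.log_exp]
      ring_nf
    rw [e]
  · obtain ⟨hS, hH⟩ := expEq_sumOn_omega hpos0 hpos1 hθ h hpos0
    refine ⟨?_, hS.trans hH.symm, hH, exists_minimizer_setFA hpos0 hpos1 h⟩
    obtain ⟨R, hR, hs⟩ := h.exists_slater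
    rw [eFA, setFA_eq_feasible]
    exact minKL_ne_top_iff.2 ⟨R, hR, fun j => (hs j).le⟩
  · have hH := omegaHat_eq_empty hpos0 hpos1 hθ h hn
    exact ⟨Set.subset_empty_iff.1 (hH ▸ omegaStar_subset_omegaHat hpos0 hpos1), hH⟩
  · obtain ⟨ec, hg, -, hH⟩ := exists_isGreatest_cost_exponent hpos0 hpos1 hθ h
    exact ⟨ec, hg, hH⟩
  · have hsf := strictlyFeasible_of_eMD_pos hpos1 hP1 h
    obtain ⟨ec, -, hS, hH⟩ := exists_isGreatest_cost_exponent hpos0 hpos1 hθ hsf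
    obtain ⟨hpS, hpH⟩ := tendsto_prob_omega hpos0 hpos1 hP1 hθ h
    -- Both denominators tend to `1`, so only the power sums matter, and these share the exponent
    -- `ec`.
    simp only [cost_eq hpos1 hθ]
    exact ⟨hsf, (hS.div_of_tendsto_one hpS).trans (hH.div_of_tendsto_one hpH).symm,
      (hS.div_of_tendsto_one hpS).trans hH.symm⟩
  · rw [eMD_eq_min, le_min_iff, le_e1_iff hpos1 hP1 hθ hE hb1, le_e2_iff hpos1 hP1 hE ht]
  · by_contra! hlt
    have heq : eFA P0 P1 θ (β + t) β = EFA := le_antisymm (hbF ▸ eFA_antitone hθ t hlt.le) h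
    exact hlt.ne' ((eFA_existsUnique hpos0 hθ hinf
      ⟨bF, hbF.ge, hbF ▸ EReal.coe_ne_top EFA⟩).unique heq hbF)
  · subst hα hβ
    have hMD : (EMD : EReal) ≤ eMD P0 P1 θ (β + t) β := by
      rw [eMD_eq_min, le_min_iff, le_e1_iff hpos1 hP1 hθ hE hb1, le_e2_iff hpos1 hP1 hE ht]
      exact ⟨hb, by linarith⟩
    refine ⟨hMD, hbF.ge, fun ε hε => ?_⟩
    exact (eventually_prob_omegaStar_compl_le hpos0 hpos1 hθ
      ((EReal.coe_lt_coe_iff.2 (by linarith)).trans_le hMD)).and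
      (eventually_prob_omegaStar_le hpos0 hpos1 hθ
        (hbF ▸ EReal.coe_lt_coe_iff.2 (by linarith)))
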